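/- All manifolds and maps are smooth and manifolds are finite-dimensional without boundary; a distribution is a smooth vector subbundle of the tangent bundle. **Pfaffian fibrations.** A Pfaffian fibration $(P,\mathcal C,\pi)$ consists of a submersion $\pi\colon P\to X$ and a distribution $\mathcal C\subseteq TP$ such that $\mathcal C+\ker T\pi=TP$ and $\mathcal C^\pi:=\mathcal C\cap\ker T\pi$ is an involutive distribution. A morphism of Pfaffian fibrations $(\Phi,\varphi)\colon(P_1,\mathcal C_1,\pi_1)\to(P_2,\mathcal C_2,\pi_2)$ consists of smooth maps $\Phi\colon P_1\to P_2$ and $\varphi\colon X_1\to X_2$ with $\pi_2\circ\Phi=\varphi\circ\pi_1$ and $T\Phi(\mathcal C_1)\subseteq\mathcal C_2$. **Relative algebroids.** A flat foliated bundle $(B,\nabla)$ over $M$ is a vector bundle $B\to M$ with a flat $\mathcal F$-connection $\nabla$, where $\mathcal F\subseteq TM$ is an involutive distribution. Let $\Omega^k_B$ be the sheaf of sections of $\wedge^kB^*$ and $\Omega^k_{(B,\nabla)}$ the subsheaf of forms that are flat for the induced connection. A relative algebroid $(B,\nabla,D)$ is a flat foliated bundle with a degree-one derivation $D\colon\Omega^\bullet_{(B,\nabla)}\to\Omega^{\bullet+1}_B$,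 i.e. an $\mathbb R$-linear map of sheaves with $D(\alpha\wedge\beta)=D\alpha\wedge\beta+(-1)^{k}\alpha\wedge D\beta$ for $\alpha$ of degree $k$. A morphism $(B_1,\nabla^1,D_1)\to(B_2,\nabla^2,D_2)$ is a smooth vector bundle map $\Psi\colon B_1\to B_2$ covering $\psi\colon M_1\to M_2$ such that $T\psi(\mathcal F_1)\subseteq\mathcal F_2$, such that $\Psi^*(\nabla^2_{T\psi(v)}\alpha)=\nabla^1_v(\Psi^*\alpha)$ for all $v\in\mathcal F_1$ and all local sections $\alpha$ of $B_2^*$ (so that $\Psi^*$ maps flat forms to flat forms), and such that $\Psi^*\circ D_2=D_1\circ\Psi^*$ on local flat forms of every degree. **The relative algebroid underlying a Pfaffian fibration** $(P,\mathcal C,\pi)$ is $(\pi^*TX,\overline\nabla,D^{\mathcal C})$, where $\mathcal F=\mathcal C^\pi$, where $\overline\nabla$ is the flat $\mathcal C^\pi$-connection on $\pi^*TX$ characterized by $\overline\nabla_v(\pi^*Z)=0$ for vector fields $Z$ on $X$, and where $$(D^{\mathcal C}\alpha)_p(b_0,\dots,b_k)=\bigl(d(\alpha\circ T\pi)\bigr)_p(c_0,\dots,c_k),\qquad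 c_i\in\mathcal C_p,\ T\pi(c_i)=b_i,$$ for flat $k$-forms $\alpha$; here $\alpha\circ T\pi$ is the $k$-form on $P$ obtained by precomposing $\alpha$ with $T\pi\colon TP\to\pi^*TX$, and the right-hand side does not depend on the choice of the lifts $c_i$. **Statement.** Let $(\Phi,\varphi)\colon(P_1,\mathcal C_1,\pi_1)\to(P_2,\mathcal C_2,\pi_2)$ be a morphism of Pfaffian fibrations. Then the canonical bundle map $\Phi_*\colon\pi_1^*TX_1\to\pi_2^*TX_2$, which covers $\Phi$ and is given by $T\varphi$ on the fibres, is a morphism of relative algebroids from $(\pi_1^*TX_1,\overline\nabla,D^{\mathcal C_1})$ to $(\pi_2^*TX_2,\overline\nabla,D^{\mathcal C_2})$. -/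

import Mathlib

open Set Bundle
open scoped Manifold ContDiff Topology

noncomputable section

namespace RelAlg

/-! ### Vector bundles, distributions and forms over a manifold -/

section General

variable {E : Type*} [NormedAddCommGroup E] [NormedSpace ℝ E]
  {M : Type*} [TopologicalSpace M] [ChartedSpace E M]

/-- The rough section `s` of the vector bundle `W → M` (with typical fibre `F`) is smooth on `U`. -/
def IsSmoothSectionOn (E : Type*) [NormedAddCommGroup E] [NormedSpace ℝ E]
    {M : Type*} [TopologicalSpace M] [ChartedSpace E M]
    (F : Type*) [NormedAddCommGroup F] [NormedSpace ℝ F] (W : M → Type*)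
    [TopologicalSpace (TotalSpace F W)] [∀ x, TopologicalSpace (W x)] [FiberBundle F W]
    (s : Π x, W x) (U : Set M) : Prop :=
  ContMDiffOn 𝓘(ℝ, E) (𝓘(ℝ, E).prod 𝓘(ℝ, F)) ∞ (fun x => TotalSpace.mk' F x (s x)) U

/-- The rough vector field `V` on `M` is smooth on `U`. -/
abbrev IsSmoothFieldOn [IsManifold 𝓘(ℝ, E) 1 M]
    (V : Π x : M, TangentSpace 𝓘(ℝ, E) x) (U : Set M) : Prop :=
  IsSmoothSectionOn E E (TangentSpace 𝓘(ℝ, E) : M → Type _) V U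

/-- `C` is a distribution, i.e. a smooth vector subbundle of `TM`: locally it has a smooth frame. -/
def IsDistribution [IsManifold 𝓘(ℝ, E) 1 M]
    (C : Π x : M, Submodule ℝ (TangentSpace 𝓘(ℝ, E) x)) : Prop :=
  ∀ x : M, ∃ U : Set M, IsOpen U ∧ x ∈ U ∧ ∃ (r : ℕ) (e : Fin r → Π y : M, TangentSpace 𝓘(ℝ, E) y),
    (∀ i, IsSmoothFieldOn (e i) U) ∧
    ∀ y ∈ U, LinearIndependent ℝ (fun i => e i y) ∧ Submodule.span ℝ (range fun i => e i y) = C y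

/-- The local sections of `C` are closed under the Lie bracket. -/
def IsInvolutive [IsManifold 𝓘(ℝ, E) 1 M]
    (C : Π x : M, Submodule ℝ (TangentSpace 𝓘(ℝ, E) x)) : Prop :=
  ∀ (U : Set M) (V W : Π x : M, TangentSpace 𝓘(ℝ, E) x), IsOpen U →
    IsSmoothFieldOn V U → IsSmoothFieldOn W U → (∀ x ∈ U, V x ∈ C x) → (∀ x ∈ U, W x ∈ C x) →
    ∀ x ∈ U, VectorField.mlieBracket 𝓘(ℝ, E) V W x ∈ C x

end General

/-! ### The wedge product -/

section Wedge

variable {V : Type*} [AddCommMonoid V] [Module ℝ V] [TopologicalSpace V]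

/-- The multilinear map `(v₁, …, v_{k+l}) ↦ a(v₁, …, v_k) b(v_{k+1}, …, v_{k+l})`. -/
def tensor {k l : ℕ} (a : V [⋀^Fin k]→L[ℝ] ℝ) (b : V [⋀^Fin l]→L[ℝ] ℝ) :
    ContinuousMultilinearMap ℝ (fun _ : Fin (k + l) => V) ℝ where
  toMultilinearMap := ((LinearMap.mul' ℝ ℝ).compMultilinearMap
    (MultilinearMap.domCoprod (a.toAlternatingMap : MultilinearMap ℝ (fun _ : Fin k => V) ℝ)
      (b.toAlternatingMap : MultilinearMap ℝ (fun _ : Fin l => V) ℝ))).domDomCongr finSumFinEquiv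
  cont := by
    have : Continuous fun v : Fin (k + l) → V =>
        a (fun i => v (Fin.castAdd l i)) * b (fun j => v (Fin.natAdd k j)) := by fun_prop
    exact this

theorem tensor_apply {k l : ℕ} (a : V [⋀^Fin k]→L[ℝ] ℝ) (b : V [⋀^Fin l]→L[ℝ] ℝ)
    (v : Fin (k + l) → V) :
    tensor a b v = a (fun i => v (Fin.castAdd l i)) * b (fun j => v (Fin.natAdd k j)) := rfl

/-- The wedge product
`(a ∧ b)(v) = 1/(k! l!) ∑_σ sgn(σ) a(v_{σ(1)}, …, v_{σ(k)}) b(v_{σ(k+1)}, …, v_{σ(k+l)})`. -/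
def wedge {k l : ℕ} (a : V [⋀^Fin k]→L[ℝ] ℝ) (b : V [⋀^Fin l]→L[ℝ] ℝ) :
    V [⋀^Fin (k + l)]→L[ℝ] ℝ :=
  ((k.factorial : ℝ) * (l.factorial : ℝ))⁻¹ • ContinuousMultilinearMap.alternatization (tensor a b)

theorem wedge_apply {k l : ℕ} (a : V [⋀^Fin k]→L[ℝ] ℝ) (b : V [⋀^Fin l]→L[ℝ] ℝ)
    (v : Fin (k + l) → V) :
    wedge a b v = ((k.factorial : ℝ) * (l.factorial : ℝ))⁻¹ * ∑ σ : Equiv.Perm (Fin (k + l)),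
      ((Equiv.Perm.sign σ : ℤ) : ℝ) * (a (fun i => v (σ (Fin.castAdd l i))) * b (fun j => v (σ (Fin.natAdd k j)))) := by
  simp [wedge, ContinuousMultilinearMap.alternatization_apply_apply, tensor_apply, Units.smul_def]

end Wedge

/-! ### Relative algebroids -/

section RelativeAlgebroid

variable (E : Type*) [NormedAddCommGroup E] [NormedSpace ℝ E]
  {M : Type*} [TopologicalSpace M] [ChartedSpace E M]
  (F : Type*) [NormedAddCommGroup F] [NormedSpace ℝ F] (W : M → Type*)
  [TopologicalSpace (TotalSpace F W)] [∀ x, AddCommMonoid (W x)] [∀ x, Module ℝ (W x)]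
  [∀ x, TopologicalSpace (W x)] [FiberBundle F W] [VectorBundle ℝ F W]

/-- Rough `k`-forms on the vector bundle `W`, i.e. rough sections of `⋀ᵏ W*`. -/
abbrev Form (W : M → Type*) [∀ x, AddCommMonoid (W x)] [∀ x, Module ℝ (W x)]
    [∀ x, TopologicalSpace (W x)] (k : ℕ) :=
  Π x : M, W x [⋀^Fin k]→L[ℝ] ℝ

/-- The `k`-form `α` is smooth on `U`: it is smooth when read in the local trivializations of `W`. -/
def IsSmoothFormOn {k : ℕ} (α : Form W k) (U : Set M) : Prop :=
  ∀ x₀ : M, ContMDiffOn 𝓘(ℝ, E) 𝓘(ℝ, F [⋀^Fin k]→L[ℝ] ℝ) ∞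
    (fun y => (α y).compContinuousLinearMap ((trivializationAt F W x₀).symmL ℝ y))
    (U ∩ (trivializationAt F W x₀).baseSet)

/-- The structure of a flat foliated bundle on the vector bundle `W → M`: a foliation `fol` of `M` (an
involutive distribution) and a flat `fol`-connection `conn` on `W`. Here `conn s x v` is `∇_v s` at `x`.
The connection is a local operator; it is applied to rough sections of `W` and its laws concern the
sections that are smooth on an open set, so that it amounts to a connection on the sheaf of sections. -/
structure FlatFoliatedBundle [IsManifold 𝓘(ℝ, E) 1 M] where
  fol : Π x : M, Submodule ℝ (TangentSpace 𝓘(ℝ, E) x)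
  fol_isDistribution : IsDistribution fol
  fol_isInvolutive : IsInvolutive fol
  conn : (Π x, W x) → Π x, fol x →ₗ[ℝ] W x
  conn_congr : ∀ (U : Set M) (s t : Π x, W x), IsOpen U → (∀ x ∈ U, s x = t x) →
    ∀ x ∈ U, conn s x = conn t x
  conn_add : ∀ (U : Set M) (s t : Π x, W x), IsOpen U →
    IsSmoothSectionOn E F W s U → IsSmoothSectionOn E F W t U →
    ∀ x ∈ U, conn (fun y => s y + t y) x = conn s x + conn t x
  conn_leibniz : ∀ (U : Set M) (f : M → ℝ) (s : Π x, W x), IsOpen U →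
    ContMDiffOn 𝓘(ℝ, E) 𝓘(ℝ, ℝ) ∞ f U → IsSmoothSectionOn E F W s U →
    ∀ x ∈ U, ∀ v : fol x, conn (fun y => f y • s y) x v =
      f x • conn s x v + mvfderiv 𝓘(ℝ, E) f x v • s x
  conn_smooth : ∀ (U : Set M) (V : Π x, fol x) (s : Π x, W x), IsOpen U →
    IsSmoothFieldOn (fun x => (V x : TangentSpace 𝓘(ℝ, E) x)) U → IsSmoothSectionOn E F W s U →
    IsSmoothSectionOn E F W (fun x => conn s x (V x)) U
  flat : ∀ (U : Set M) (V V' : Π x, fol x) (s : Π x, W x) (hU : IsOpen U)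
    (hV : IsSmoothFieldOn (fun x => (V x : TangentSpace 𝓘(ℝ, E) x)) U)
    (hV' : IsSmoothFieldOn (fun x => (V' x : TangentSpace 𝓘(ℝ, E) x)) U),
    IsSmoothSectionOn E F W s U → ∀ (x : M) (hx : x ∈ U),
    conn (fun y => conn s y (V' y)) x (V x) = conn (fun y => conn s y (V y)) x (V' x) +
      conn s x ⟨VectorField.mlieBracket 𝓘(ℝ, E) (fun y => V y) (fun y => V' y) x,
        fol_isInvolutive U _ _ hU hV hV' (fun y _ => (V y).2) (fun y _ => (V' y).2) x hx⟩

variable {E F W}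

/-- The value `(∇_v α)(b₁, …, b_k) = v(α(b₁, …, b_k)) - ∑ᵢ α(b₁, …, ∇_v bᵢ, …, b_k)` at `x` of the
connection induced on `⋀ᵏ W*`, computed with local sections `bᵢ` of `W`. -/
def FlatFoliatedBundle.covForm [IsManifold 𝓘(ℝ, E) 1 M] (A : FlatFoliatedBundle E F W) {k : ℕ}
    (α : Form W k) (b : Fin k → Π x, W x) (x : M) (v : A.fol x) : ℝ :=
  mvfderiv 𝓘(ℝ, E) (fun y => α y fun i => b i y) x (v : TangentSpace 𝓘(ℝ, E) x) -
    ∑ i, α x (Function.update (fun j => b j x) i (A.conn (b i) x v))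

/-- `α` is a flat smooth `k`-form over `U`, i.e. a section over `U` of the sheaf `Ωᵏ_(W,∇)`. -/
structure FlatFoliatedBundle.IsFlatFormOn [IsManifold 𝓘(ℝ, E) 1 M] (A : FlatFoliatedBundle E F W)
    {k : ℕ} (α : Form W k) (U : Set M) : Prop where
  smooth : IsSmoothFormOn E F W α U
  flat : ∀ x ∈ U, ∀ v : A.fol x, ∀ (V : Set M) (b : Fin k → Π x, W x), IsOpen V → x ∈ V →
    (∀ i, IsSmoothSectionOn E F W (b i) V) → A.covForm α b x v = 0

variable (E F W) in
/-- A relative algebroid: a flat foliated bundle together with a derivation `D` of degree one from the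
sheaf of flat forms to the sheaf of all forms on `W`. It is given as a local operator on rough forms;
only its values on smooth flat forms over open sets are meaningful, and the laws concern those. -/
structure RelativeAlgebroid [IsManifold 𝓘(ℝ, E) 1 M] extends FlatFoliatedBundle E F W where
  D : ∀ {k : ℕ}, Form W k → Form W (k + 1)
  D_congr : ∀ {k : ℕ} (U : Set M) (α β : Form W k), IsOpen U → (∀ x ∈ U, α x = β x) →
    ∀ x ∈ U, D α x = D β x
  D_smooth : ∀ {k : ℕ} (U : Set M) (α : Form W k), IsOpen U →
    toFlatFoliatedBundle.IsFlatFormOn α U → IsSmoothFormOn E F W (D α) U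
  D_add : ∀ {k : ℕ} (U : Set M) (α β : Form W k), IsOpen U →
    toFlatFoliatedBundle.IsFlatFormOn α U → toFlatFoliatedBundle.IsFlatFormOn β U →
    ∀ x ∈ U, D (fun y => α y + β y) x = D α x + D β x
  D_smul : ∀ {k : ℕ} (U : Set M) (c : ℝ) (α : Form W k), IsOpen U →
    toFlatFoliatedBundle.IsFlatFormOn α U → ∀ x ∈ U, D (fun y => c • α y) x = c • D α x
  D_leibniz : ∀ {k l : ℕ} (U : Set M) (α : Form W k) (β : Form W l), IsOpen U →
    toFlatFoliatedBundle.IsFlatFormOn α U → toFlatFoliatedBundle.IsFlatFormOn β U →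
    ∀ x ∈ U, ∀ w : Fin (k + l + 1) → W x, D (fun y => wedge (α y) (β y)) x w =
      wedge (D α x) (β x) (w ∘ Fin.cast (by omega)) + (-1) ^ k * wedge (α x) (D β x) w

end RelativeAlgebroid

section Morphism

variable {E₁ : Type*} [NormedAddCommGroup E₁] [NormedSpace ℝ E₁]
  {M₁ : Type*} [TopologicalSpace M₁] [ChartedSpace E₁ M₁] [IsManifold 𝓘(ℝ, E₁) 1 M₁]
  {F₁ : Type*} [NormedAddCommGroup F₁] [NormedSpace ℝ F₁] {W₁ : M₁ → Type*}
  [TopologicalSpace (TotalSpace F₁ W₁)] [∀ x, AddCommMonoid (W₁ x)] [∀ x, Module ℝ (W₁ x)]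
  [∀ x, TopologicalSpace (W₁ x)] [FiberBundle F₁ W₁] [VectorBundle ℝ F₁ W₁]
  {E₂ : Type*} [NormedAddCommGroup E₂] [NormedSpace ℝ E₂]
  {M₂ : Type*} [TopologicalSpace M₂] [ChartedSpace E₂ M₂] [IsManifold 𝓘(ℝ, E₂) 1 M₂]
  {F₂ : Type*} [NormedAddCommGroup F₂] [NormedSpace ℝ F₂] {W₂ : M₂ → Type*}
  [TopologicalSpace (TotalSpace F₂ W₂)] [∀ x, AddCommMonoid (W₂ x)] [∀ x, Module ℝ (W₂ x)]
  [∀ x, TopologicalSpace (W₂ x)] [FiberBundle F₂ W₂] [VectorBundle ℝ F₂ W₂]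

/-- The pullback `Φ*α` of a form along a bundle map `Φ` covering `φ`. -/
def pullbackForm (φ : M₁ → M₂) (Φ : Π x, W₁ x →L[ℝ] W₂ (φ x)) {k : ℕ} (α : Form W₂ k) :
    Form W₁ k :=
  fun x => (α (φ x)).compContinuousLinearMap (Φ x)

/-- The bundle map `Φ : W₁ → W₂` over `φ` is a smooth morphism of flat foliated bundles: `Tφ` maps the
foliation of `M₁` into that of `M₂`, and `Φ*(∇_{Tφ(v)} α) = ∇_v (Φ*α)` for all local sections `α` of
`W₂*`. The last equation is evaluated on `b₁(x) ∈ W₁`, where `b₁` is any local section of `W₁` and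
`b₂` any local section of `W₂` with `b₂(φ(x)) = Φ(b₁(x))`. -/
structure IsFoliatedBundleMap (A₁ : FlatFoliatedBundle E₁ F₁ W₁) (A₂ : FlatFoliatedBundle E₂ F₂ W₂)
    (φ : M₁ → M₂) (Φ : Π x, W₁ x →L[ℝ] W₂ (φ x)) : Prop where
  smooth_base : ContMDiff 𝓘(ℝ, E₁) 𝓘(ℝ, E₂) ∞ φ
  smooth : ContMDiff (𝓘(ℝ, E₁).prod 𝓘(ℝ, F₁)) (𝓘(ℝ, E₂).prod 𝓘(ℝ, F₂)) ∞
    (fun w : TotalSpace F₁ W₁ => TotalSpace.mk' F₂ (φ w.proj) (Φ w.proj w.snd))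
  map_fol : ∀ (x : M₁) (v : TangentSpace 𝓘(ℝ, E₁) x), v ∈ A₁.fol x →
    mfderiv 𝓘(ℝ, E₁) 𝓘(ℝ, E₂) φ x v ∈ A₂.fol (φ x)
  map_conn : ∀ (U : Set M₂) (α : Form W₂ 1), IsOpen U → IsSmoothFormOn E₂ F₂ W₂ α U →
    ∀ (x : M₁), φ x ∈ U → ∀ v : A₁.fol x,
    ∀ (V₁ : Set M₁) (b₁ : Π x, W₁ x) (V₂ : Set M₂) (b₂ : Π x, W₂ x),
    IsOpen V₁ → x ∈ V₁ → IsSmoothSectionOn E₁ F₁ W₁ b₁ V₁ →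
    IsOpen V₂ → φ x ∈ V₂ → IsSmoothSectionOn E₂ F₂ W₂ b₂ V₂ → b₂ (φ x) = Φ x (b₁ x) →
    A₂.covForm α (fun _ => b₂) (φ x) ⟨mfderiv 𝓘(ℝ, E₁) 𝓘(ℝ, E₂) φ x v, map_fol x v v.2⟩ =
      A₁.covForm (pullbackForm φ Φ α) (fun _ => b₁) x v

/-- The bundle map `Φ : W₁ → W₂` over `φ` is a morphism of relative algebroids: it is a morphism of flat
foliated bundles, `Φ*` maps flat forms to flat forms, and `Φ* ∘ D₂ = D₁ ∘ Φ*` on flat forms. -/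
structure IsRelativeAlgebroidMorphism (A₁ : RelativeAlgebroid E₁ F₁ W₁)
    (A₂ : RelativeAlgebroid E₂ F₂ W₂) (φ : M₁ → M₂) (Φ : Π x, W₁ x →L[ℝ] W₂ (φ x)) : Prop
    extends IsFoliatedBundleMap A₁.toFlatFoliatedBundle A₂.toFlatFoliatedBundle φ Φ where
  map_flat : ∀ {k : ℕ} (U : Set M₂) (α : Form W₂ k), IsOpen U →
    A₂.toFlatFoliatedBundle.IsFlatFormOn α U →
    A₁.toFlatFoliatedBundle.IsFlatFormOn (pullbackForm φ Φ α) (φ ⁻¹' U)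
  map_D : ∀ {k : ℕ} (U : Set M₂) (α : Form W₂ k), IsOpen U →
    A₂.toFlatFoliatedBundle.IsFlatFormOn α U →
    ∀ x ∈ φ ⁻¹' U, pullbackForm φ Φ (A₂.D α) x = A₁.D (pullbackForm φ Φ α) x

end Morphism

section Pfaffian

variable {E : Type*} [NormedAddCommGroup E] [NormedSpace ℝ E]
  {P : Type*} [TopologicalSpace P] [ChartedSpace E P] [IsManifold 𝓘(ℝ, E) ∞ P]
  {E' : Type*} [NormedAddCommGroup E'] [NormedSpace ℝ E']
  {X : Type*} [TopologicalSpace X] [ChartedSpace E' X] [IsManifold 𝓘(ℝ, E') ∞ X]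

/-- The exterior derivative of a `k`-form on a manifold, computed in a chart. -/
def extDer {k : ℕ} (η : Form (TangentSpace 𝓘(ℝ, E) : P → Type _) k) :
    Form (TangentSpace 𝓘(ℝ, E) : P → Type _) (k + 1) := fun p =>
  (extDeriv (F := ℝ) (fun y : E => ((η ((extChartAt 𝓘(ℝ, E) p).symm y)).compContinuousLinearMap
      (mfderiv 𝓘(ℝ, E) 𝓘(ℝ, E) (extChartAt 𝓘(ℝ, E) p).symm y) : E [⋀^Fin k]→L[ℝ] ℝ))
    (extChartAt 𝓘(ℝ, E) p p)).compContinuousLinearMap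
      (mfderiv 𝓘(ℝ, E) 𝓘(ℝ, E) (extChartAt 𝓘(ℝ, E) p) p)

variable (P X E E') in
/-- A Pfaffian fibration `(P, C, π)`: a submersion `π : P → X` and a distribution `C ⊆ TP` such that
`C + ker Tπ = TP` and `C ∩ ker Tπ` is an involutive distribution. -/
structure PfaffianFibration where
  proj : ContMDiffMap 𝓘(ℝ, E) 𝓘(ℝ, E') P X ∞
  C : Π p : P, Submodule ℝ (TangentSpace 𝓘(ℝ, E) p)
  submersion : ∀ p, Function.Surjective (mfderiv 𝓘(ℝ, E) 𝓘(ℝ, E') proj p)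
  isDistribution : IsDistribution C
  transversal : ∀ p, C p ⊔ LinearMap.ker (mfderiv 𝓘(ℝ, E) 𝓘(ℝ, E') proj p).toLinearMap = ⊤
  vert_isDistribution : IsDistribution fun p =>
    C p ⊓ LinearMap.ker (mfderiv 𝓘(ℝ, E) 𝓘(ℝ, E') proj p).toLinearMap
  vert_isInvolutive : IsInvolutive fun p =>
    C p ⊓ LinearMap.ker (mfderiv 𝓘(ℝ, E) 𝓘(ℝ, E') proj p).toLinearMap

namespace PfaffianFibration

variable (Q : PfaffianFibration E P E' X)

/-- The bundle `B = π*TX` over `P`. -/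
abbrev B (p : P) : Type _ := (Q.proj *ᵖ (TangentSpace 𝓘(ℝ, E') : X → Type _)) p

/-- The foliation `C ∩ ker Tπ`. -/
abbrev vert (p : P) : Submodule ℝ (TangentSpace 𝓘(ℝ, E) p) :=
    Q.C p ⊓ LinearMap.ker (mfderiv 𝓘(ℝ, E) 𝓘(ℝ, E') Q.proj p).toLinearMap

/-- The canonical flat connection on `π*TX` along `C ∩ ker Tπ`: in the trivialization of `π*TX` that is
pulled back from a chart of `X`, it is the derivative. It satisfies the Leibniz rule, and `∇_v π*Z = 0` for
vector fields `Z` on `X`; both are proved below. -/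
def conn (s : Π p, Q.B p) (p : P) : Q.vert p →ₗ[ℝ] Q.B p :=
  ((trivializationAt E' Q.B p).symmL ℝ p ∘L
    mvfderiv 𝓘(ℝ, E) (fun q => (trivializationAt E' Q.B p ⟨q, s q⟩).2) p).toLinearMap ∘ₗ
    (Q.vert p).subtype

/-- The differential of the projection, as a bundle map `TP → π*TX`. -/
def dproj (p : P) : TangentSpace 𝓘(ℝ, E) p →L[ℝ] Q.B p := mfderiv 𝓘(ℝ, E) 𝓘(ℝ, E') Q.proj p

/-- The inclusion `I` of forms on `π*TX` into forms on `P`, i.e. precomposition with `Tπ`. -/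
def inclForm {k : ℕ} (α : Form Q.B k) : Form (TangentSpace 𝓘(ℝ, E) : P → Type _) k := fun p =>
  (α p).compContinuousLinearMap (Q.dproj p)

theorem exists_lift [FiniteDimensional ℝ E'] (p : P) : ∃ L : Q.B p →L[ℝ] TangentSpace 𝓘(ℝ, E) p, (∀ b, L b ∈ Q.C p) ∧
    ∀ b, Q.dproj p (L b) = b := by
  let T : E →L[ℝ] E' := mfderiv 𝓘(ℝ, E) 𝓘(ℝ, E') Q.proj p
  let C : Submodule ℝ E := Q.C p
  have hsurj : Function.Surjective (T.toLinearMap.domRestrict C) := by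
    intro b
    obtain ⟨u, hu⟩ := Q.submersion p b
    have hm : (show E from u) ∈ C ⊔ LinearMap.ker T.toLinearMap := by
      have := Q.transversal p
      change C ⊔ LinearMap.ker T.toLinearMap = ⊤ at this
      rw [this]; trivial
    obtain ⟨c, hc, w, hw, h⟩ := Submodule.mem_sup.1 hm
    refine ⟨⟨c, hc⟩, ?_⟩
    have hw' : T w = 0 := hw
    have : T u = T c + T w := by rw [← map_add]; exact congrArg T h.symm
    rw [hw', add_zero] at this
    exact this.symm.trans hu
  obtain ⟨g, hg⟩ := (T.toLinearMap.domRestrict C).exists_rightInverse_of_surjective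
    (LinearMap.range_eq_top.2 hsurj)
  refine ⟨(show E' →L[ℝ] E from LinearMap.toContinuousLinearMap (C.subtype ∘ₗ g)), fun b => (g b).2,
    fun b => ?_⟩
  exact LinearMap.congr_fun hg b


/-- A linear lift `(π*TX)_p → C_p` of `Tπ`. It is unique up to `C ∩ ker Tπ`; the derivation of a flat form
does not depend on the choice (see `rd_D` below). -/
def lift [FiniteDimensional ℝ E'] (p : P) : Q.B p →L[ℝ] TangentSpace 𝓘(ℝ, E) p := (Q.exists_lift p).choose

/-- The derivation `D α = Π(d I(α))`, where `Π` is precomposition with the lift `π*TX → C`. -/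
def D [FiniteDimensional ℝ E'] {k : ℕ} (α : Form Q.B k) : Form Q.B (k + 1) := fun p =>
  (extDer (Q.inclForm α) p).compContinuousLinearMap (Q.lift p)

end PfaffianFibration
end Pfaffian

end RelAlg

namespace RelAlg
section Calc

variable {E : Type*} [NormedAddCommGroup E] [NormedSpace ℝ E]
  {M : Type*} [TopologicalSpace M] [ChartedSpace E M]
  {G : Type*} [NormedAddCommGroup G] [NormedSpace ℝ G]

theorem hasFDerivAt_chart {g : M → G} {p : M} (hg : MDifferentiableAt 𝓘(ℝ, E) 𝓘(ℝ, G) g p) :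
    HasFDerivAt (fun z => g ((extChartAt 𝓘(ℝ, E) p).symm z))
      (show E →L[ℝ] G from mvfderiv 𝓘(ℝ, E) g p) (extChartAt 𝓘(ℝ, E) p p) := by
  have h := hg.hasMFDerivAt.2
  simp only [ModelWithCorners.range_eq_univ] at h
  exact hasFDerivWithinAt_univ.1 h

theorem mdiff_of_smoothOn {g : M → G} {U : Set M} (hU : IsOpen U)
    (hg : ContMDiffOn 𝓘(ℝ, E) 𝓘(ℝ, G) ∞ g U) {p : M} (hp : p ∈ U) :
    MDifferentiableAt 𝓘(ℝ, E) 𝓘(ℝ, G) g p :=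
  (hg.contMDiffAt (hU.mem_nhds hp)).mdifferentiableAt (by simp)

/-- derivative in a chart at nearby points -/
theorem fderiv_chart_symm [IsManifold 𝓘(ℝ, E) 1 M] {g : M → G} {p : M} {z : E}
    (hz : z ∈ (extChartAt 𝓘(ℝ, E) p).target)
    (hg : MDifferentiableAt 𝓘(ℝ, E) 𝓘(ℝ, G) g ((extChartAt 𝓘(ℝ, E) p).symm z)) :
    HasFDerivAt (fun z => g ((extChartAt 𝓘(ℝ, E) p).symm z))
      (show E →L[ℝ] G from (mvfderiv 𝓘(ℝ, E) g ((extChartAt 𝓘(ℝ, E) p).symm z)) ∘L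
        (mfderiv 𝓘(ℝ, E) 𝓘(ℝ, E) (extChartAt 𝓘(ℝ, E) p).symm z)) z := by
  have h1 := mdifferentiableWithinAt_extChartAt_symm (I := 𝓘(ℝ, E)) hz
  simp only [ModelWithCorners.range_eq_univ, mdifferentiableWithinAt_univ] at h1
  exact (hg.hasMFDerivAt.comp z h1.hasMFDerivAt).hasFDerivAt

theorem contDiffAt_chart [IsManifold 𝓘(ℝ, E) ∞ M] {g : M → G} {U : Set M} (hU : IsOpen U)
    (hg : ContMDiffOn 𝓘(ℝ, E) 𝓘(ℝ, G) ∞ g U) {p : M} (hp : p ∈ U) :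
    ContDiffAt ℝ ∞ (fun z => g ((extChartAt 𝓘(ℝ, E) p).symm z)) (extChartAt 𝓘(ℝ, E) p p) := by
  have h := (contMDiffAt_iff.1 (hg.contMDiffAt (hU.mem_nhds hp))).2
  simp only [ModelWithCorners.range_eq_univ, contDiffWithinAt_univ] at h
  exact h

/-- The derivative of a smooth function along a smooth field is smooth. -/
theorem smooth_mvfderiv [IsManifold 𝓘(ℝ, E) ∞ M] {g : M → G} {U : Set M} (hU : IsOpen U)
    (hg : ContMDiffOn 𝓘(ℝ, E) 𝓘(ℝ, G) ∞ g U) {V : Π x : M, TangentSpace 𝓘(ℝ, E) x}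
    (hV : IsSmoothFieldOn V U) :
    ContMDiffOn 𝓘(ℝ, E) 𝓘(ℝ, G) ∞ (fun y => mvfderiv 𝓘(ℝ, E) g y (V y)) U := by
  have h1 := (hg.contMDiffOn_tangentMapWithin (m := ∞) (by simp) hU.uniqueMDiffOn).comp
    hV (fun y hy => hy)
  have h2 := contMDiff_snd_tangentBundle_modelSpace (𝕜 := ℝ) (E := G) (H := G) 𝓘(ℝ, G) (n := ∞) |>.comp_contMDiffOn h1
  refine h2.congr fun y hy => ?_
  change _ = mfderivWithin 𝓘(ℝ, E) 𝓘(ℝ, G) g U y (V y)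
  rw [mfderivWithin_of_isOpen hU hy]
  rfl

theorem mvfderiv_bracket [CompleteSpace E] [IsManifold 𝓘(ℝ, E) ∞ M] {g : M → G} {U : Set M} (hU : IsOpen U)
    (hg : ContMDiffOn 𝓘(ℝ, E) 𝓘(ℝ, G) ∞ g U) {V W : Π x : M, TangentSpace 𝓘(ℝ, E) x}
    (hV : IsSmoothFieldOn V U) (hW : IsSmoothFieldOn W U) {p : M} (hp : p ∈ U) :
    mvfderiv 𝓘(ℝ, E) g p (VectorField.mlieBracket 𝓘(ℝ, E) V W p) =
      mvfderiv 𝓘(ℝ, E) (fun y => mvfderiv 𝓘(ℝ, E) g y (W y)) p (V p) -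
      mvfderiv 𝓘(ℝ, E) (fun y => mvfderiv 𝓘(ℝ, E) g y (V y)) p (W p) := by
  set φ := extChartAt 𝓘(ℝ, E) p with hφ
  let hat (V : Π x : M, TangentSpace 𝓘(ℝ, E) x) : E → E := 
    VectorField.mpullbackWithin 𝓘(ℝ, E) 𝓘(ℝ, E) φ.symm V (range 𝓘(ℝ, E))
  have hdiff : ∀ V : Π x : M, TangentSpace 𝓘(ℝ, E) x, IsSmoothFieldOn V U →
      DifferentiableAt ℝ (hat V) (φ p) := by
    intro V hV
    have h1 := (hV.contMDiffAt (hU.mem_nhds hp)).mdifferentiableAt (by simp)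
    have h2 := (mdifferentiableWithinAt_univ.2 h1).differentiableWithinAt_mpullbackWithin_vectorField
    simp only [ModelWithCorners.range_eq_univ, preimage_univ, inter_univ] at h2
    have h3 := differentiableWithinAt_univ.1 h2
    simpa only [hat, ModelWithCorners.range_eq_univ] using h3
  have hbr : VectorField.mlieBracket 𝓘(ℝ, E) V W p = VectorField.lieBracket ℝ (hat V) (hat W) (φ p) := by
    have hinv := isInvertible_mfderiv_extChartAt (I := 𝓘(ℝ, E)) (mem_extChartAt_source (I := 𝓘(ℝ, E)) p)
    refine (VectorField.mlieBracketWithin_apply (I := 𝓘(ℝ, E)) (V := V) (W := W) (s := univ)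
      (x₀ := p)).trans ?_
    refine (hinv.inverse_apply_eq).2 ?_
    have h0 : ∀ u : E, mfderiv 𝓘(ℝ, E) 𝓘(ℝ, E) (extChartAt 𝓘(ℝ, E) p) p u = u := fun u => by
      rw [mfderiv_extChartAt_self]; rfl
    refine Eq.trans ?_ (h0 _).symm
    have hr : φ.symm ⁻¹' univ ∩ range 𝓘(ℝ, E) = univ := by simp
    have h5 : VectorField.lieBracketWithin ℝ (hat V) (hat W) (φ.symm ⁻¹' univ ∩ range 𝓘(ℝ, E))
        (φ p) = VectorField.lieBracket ℝ (hat V) (hat W) (φ p) := by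
      rw [hr, VectorField.lieBracketWithin_univ]
    exact h5
  have htar : ∀ᶠ z in 𝓝 (φ p), z ∈ φ.target ∧ φ.symm z ∈ U := by
    have h1 : φ.target ∈ 𝓝 (φ p) := extChartAt_target_mem_nhds (I := 𝓘(ℝ, E)) p
    have h2 : ContinuousAt φ.symm (φ p) := continuousAt_extChartAt_symm p
    have h3 : φ.symm (φ p) = p := extChartAt_to_inv p
    filter_upwards [h1, h2.preimage_mem_nhds (by rw [h3]; exact hU.mem_nhds hp)] with z h h'
    exact ⟨h, h'⟩
  have key : ∀ V : Π x : M, TangentSpace 𝓘(ℝ, E) x,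
      (fun z => mvfderiv 𝓘(ℝ, E) g (φ.symm z) (V (φ.symm z))) =ᶠ[𝓝 (φ p)]
      fun z => fderiv ℝ (fun z => g (φ.symm z)) z (hat V z) := by
    intro V
    filter_upwards [htar] with z hz
    rw [(fderiv_chart_symm hz.1 (mdiff_of_smoothOn hU hg hz.2)).fderiv]
    have hinv := isInvertible_mfderivWithin_extChartAt_symm (I := 𝓘(ℝ, E)) hz.1
    have h1 := hinv.self_apply_inverse (V (φ.symm z))
    simp only [ModelWithCorners.range_eq_univ, mfderivWithin_univ] at h1
    have h2 : mfderiv 𝓘(ℝ, E) 𝓘(ℝ, E) φ.symm z (hat V z) = V (φ.symm z) := by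
      simp only [hat, VectorField.mpullbackWithin_apply, ModelWithCorners.range_eq_univ,
        mfderivWithin_univ]
      exact h1
    exact congrArg (mvfderiv 𝓘(ℝ, E) g (φ.symm z)) h2.symm
  have key2 : ∀ V W: Π x : M, TangentSpace 𝓘(ℝ, E) x, IsSmoothFieldOn V U → IsSmoothFieldOn W U →
      mvfderiv 𝓘(ℝ, E) (fun y => mvfderiv 𝓘(ℝ, E) g y (W y)) p (V p) = 
      fderiv ℝ (fun z => fderiv ℝ (fun z => g (φ.symm z)) z (hat W z)) (φ p) (hat V (φ p)) := by
    intro V W hV hW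
    rw [← (key W).fderiv_eq, (hasFDerivAt_chart (mdiff_of_smoothOn hU (smooth_mvfderiv hU hg hW) hp)).fderiv]
    have h1 : hat V (φ p) = V p := by
      have h2 : ∀ y, y = p → (show E from V y) = V p := by rintro y rfl; rfl
      have h3 := mfderivWithin_extChartAt_symm_inverse_apply (I := 𝓘(ℝ, E)) (x := p)
        (show E from V (φ.symm (φ p)))
      exact Eq.trans h3 (h2 _ (extChartAt_to_inv p))
    rw [h1]
    rfl
  rw [key2 V W hV hW, key2 W V hW hV, hbr]
  have := VectorField.fderiv_apply_lieBracket (contDiffAt_chart hU hg hp) (by simpa using (mod_cast le_top : ((2 : ℕ∞) : WithTop ℕ∞) ≤ ∞)) (hdiff W hW) (hdiff V hV)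
  rw [← this, (hasFDerivAt_chart (mdiff_of_smoothOn hU hg hp)).fderiv]
  rfl

end Calc
end RelAlg

namespace RelAlg
section Calc2
variable {E : Type*} [NormedAddCommGroup E] [NormedSpace ℝ E]
  {M : Type*} [TopologicalSpace M] [ChartedSpace E M]
  {G : Type*} [NormedAddCommGroup G] [NormedSpace ℝ G]
  {G' : Type*} [NormedAddCommGroup G'] [NormedSpace ℝ G']

theorem mvfderiv_congr {g h : M → G} {p : M} (hgh : g =ᶠ[𝓝 p] h) :
    mvfderiv 𝓘(ℝ, E) g p = mvfderiv 𝓘(ℝ, E) h p := by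
  ext v
  have h1 := hgh.mfderiv_eq (I := 𝓘(ℝ, E)) (I' := 𝓘(ℝ, G))
  exact congrArg (fun L : E →L[ℝ] G => L v) h1

theorem mvfderiv_clm_apply {A : M → G →L[ℝ] G'} {h : M → G} {p : M}
    (hA : MDifferentiableAt 𝓘(ℝ, E) 𝓘(ℝ, G →L[ℝ] G') A p)
    (hh : MDifferentiableAt 𝓘(ℝ, E) 𝓘(ℝ, G) h p) (v : TangentSpace 𝓘(ℝ, E) p) :
    mvfderiv 𝓘(ℝ, E) (fun y => A y (h y)) p v =
      mvfderiv 𝓘(ℝ, E) A p v (h p) + A p (mvfderiv 𝓘(ℝ, E) h p v) := by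
  have h1 := (hasFDerivAt_chart hA).clm_apply (hasFDerivAt_chart hh)
  have h2 := hasFDerivAt_chart (hA.clm_apply hh)
  have h3 := h2.unique h1
  have h4 := congrArg (fun L : E →L[ℝ] G' => L v) h3
  simp only [extChartAt_to_inv] at h4
  refine h4.trans ?_
  simp [add_comm]
  rfl

theorem mvfderiv_comp_vec {E₂ : Type*} [NormedAddCommGroup E₂] [NormedSpace ℝ E₂]
    {M₂ : Type*} [TopologicalSpace M₂] [ChartedSpace E₂ M₂] {g : M₂ → G} {f : M → M₂} {p : M}
    (hg : MDifferentiableAt 𝓘(ℝ, E₂) 𝓘(ℝ, G) g (f p))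
    (hf : MDifferentiableAt 𝓘(ℝ, E) 𝓘(ℝ, E₂) f p) (v : TangentSpace 𝓘(ℝ, E) p) :
    mvfderiv 𝓘(ℝ, E) (fun y => g (f y)) p v =
      mvfderiv 𝓘(ℝ, E₂) g (f p) (mfderiv 𝓘(ℝ, E) 𝓘(ℝ, E₂) f p v) :=
  mfderiv_comp_apply p hg hf v

end Calc2

namespace PfaffianFibration
variable {E : Type*} [NormedAddCommGroup E] [NormedSpace ℝ E]
  {P : Type*} [TopologicalSpace P] [ChartedSpace E P] [IsManifold 𝓘(ℝ, E) ∞ P]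
  {E' : Type*} [NormedAddCommGroup E'] [NormedSpace ℝ E']
  {X : Type*} [TopologicalSpace X] [ChartedSpace E' X] [IsManifold 𝓘(ℝ, E') ∞ X]
variable (Q : PfaffianFibration E P E' X)

/-- A section of `π*TX`, read in the trivialization around `p`. -/
abbrev tr (p : P) (s : Π p, Q.B p) (y : P) : E' := (trivializationAt E' Q.B p ⟨y, s y⟩).2
/-- The domain of the trivialization of `π*TX` around `p`. -/
abbrev base (p : P) : Set P := (trivializationAt E' Q.B p).baseSet

theorem mem_base (p : P) : p ∈ Q.base p := FiberBundle.mem_baseSet_trivializationAt' p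
theorem isOpen_base (p : P) : IsOpen (Q.base p) := (trivializationAt E' Q.B p).open_baseSet

theorem smooth_tr {s : Π p, Q.B p} {U : Set P} (hU : IsOpen U)
    (hs : IsSmoothSectionOn E E' Q.B s U) (p : P) :
    ContMDiffOn 𝓘(ℝ, E) 𝓘(ℝ, E') ∞ (Q.tr p s) (U ∩ Q.base p) :=
  ((trivializationAt E' Q.B p).contMDiffOn_section_iff (hU.inter (Q.isOpen_base p))
    inter_subset_right).1 (hs.mono inter_subset_left)

/-- The transition function between two trivializations of `π*TX`. -/
abbrev chg (p q : P) (y : P) : E' →L[ℝ] E' :=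
  (trivializationAt E' Q.B p).coordChangeL ℝ (trivializationAt E' Q.B q) y

theorem chg_apply {p q y : P} (hp : y ∈ Q.base p) (hq : y ∈ Q.base q) (b : Q.B y) :
    Q.chg p q y (trivializationAt E' Q.B p ⟨y, b⟩).2 = (trivializationAt E' Q.B q ⟨y, b⟩).2 := by
  have := (trivializationAt E' Q.B p).coordChangeL_apply (R := ℝ) (trivializationAt E' Q.B q)
    ⟨hp, hq⟩ (trivializationAt E' Q.B p ⟨y, b⟩).2
  refine this.trans ?_
  rw [(trivializationAt E' Q.B p).symm_proj_apply ⟨y, b⟩ hp]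

theorem chg_smooth (p q : P) :
    ContMDiffOn 𝓘(ℝ, E) 𝓘(ℝ, E' →L[ℝ] E') ∞ (Q.chg p q) (Q.base p ∩ Q.base q) :=
  contMDiffOn_coordChangeL (IB := 𝓘(ℝ, E)) (n := ∞) (trivializationAt E' Q.B p) (trivializationAt E' Q.B q)

theorem chg_eq {p q y : P} (hp : y ∈ Q.base p) (hq : y ∈ Q.base q) :
    Q.chg p q y = ((trivializationAt E' (TangentSpace 𝓘(ℝ, E') : X → Type _) (Q.proj p)).coordChangeL ℝ
      (trivializationAt E' (TangentSpace 𝓘(ℝ, E') : X → Type _) (Q.proj q)) (Q.proj y) : E' →L[ℝ] E') := by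
  ext v
  have h1 := (trivializationAt E' Q.B p).coordChangeL_apply' (R := ℝ) (trivializationAt E' Q.B q) ⟨hp, hq⟩ v
  have h2 := (trivializationAt E' (TangentSpace 𝓘(ℝ, E') : X → Type _) (Q.proj p)).coordChangeL_apply
    (R := ℝ) (trivializationAt E' (TangentSpace 𝓘(ℝ, E') : X → Type _) (Q.proj q)) (b := Q.proj y) ⟨hp, hq⟩ v
  exact h1.trans h2.symm

theorem mvfderiv_chg {p q y : P} (hp : y ∈ Q.base p) (hq : y ∈ Q.base q)
    (v : TangentSpace 𝓘(ℝ, E) y) (hv : mfderiv 𝓘(ℝ, E) 𝓘(ℝ, E') Q.proj y v = 0) :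
    mvfderiv 𝓘(ℝ, E) (Q.chg p q) y v = 0 := by
  let g : X → E' →L[ℝ] E' := fun x =>
    ((trivializationAt E' (TangentSpace 𝓘(ℝ, E') : X → Type _) (Q.proj p)).coordChangeL ℝ
      (trivializationAt E' (TangentSpace 𝓘(ℝ, E') : X → Type _) (Q.proj q)) x : E' →L[ℝ] E')
  have h1 : Q.chg p q =ᶠ[𝓝 y] fun z => g (Q.proj z) := by
    filter_upwards [(Q.isOpen_base p).mem_nhds hp, (Q.isOpen_base q).mem_nhds hq] with z h h'
    exact Q.chg_eq h h'
  have hg := contMDiffOn_coordChangeL (IB := 𝓘(ℝ, E')) (n := ∞)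
    (trivializationAt E' (TangentSpace 𝓘(ℝ, E') : X → Type _) (Q.proj p))
    (trivializationAt E' (TangentSpace 𝓘(ℝ, E') : X → Type _) (Q.proj q))
  have hg' : MDifferentiableAt 𝓘(ℝ, E') 𝓘(ℝ, E' →L[ℝ] E') g (Q.proj y) :=
    mdiff_of_smoothOn ((trivializationAt E' (TangentSpace 𝓘(ℝ, E') : X → Type _) (Q.proj p)).open_baseSet.inter
      (trivializationAt E' (TangentSpace 𝓘(ℝ, E') : X → Type _) (Q.proj q)).open_baseSet) hg ⟨hp, hq⟩
  rw [mvfderiv_congr h1, mvfderiv_comp_vec hg'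
    (Q.proj.contMDiff.mdifferentiable (by simp) y), hv, map_zero]

/-- the connection can be computed in any of the trivializations -/
theorem tr_conn {s : Π p, Q.B p} {U : Set P} (hU : IsOpen U)
    (hs : IsSmoothSectionOn E E' Q.B s U) {p y : P} (hy : y ∈ U) (hp : y ∈ Q.base p) (v : Q.vert y) :
    (trivializationAt E' Q.B p ⟨y, Q.conn s y v⟩).2 = mvfderiv 𝓘(ℝ, E) (Q.tr p s) y (v : TangentSpace 𝓘(ℝ, E) y) := by
  have hyy := Q.mem_base y
  have hv0 : mfderiv 𝓘(ℝ, E) 𝓘(ℝ, E') Q.proj y (v : TangentSpace 𝓘(ℝ, E) y) = 0 := v.2.2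
  have h1 : Q.tr p s =ᶠ[𝓝 y] fun z => Q.chg y p z (Q.tr y s z) := by
    filter_upwards [(Q.isOpen_base p).mem_nhds hp, (Q.isOpen_base y).mem_nhds hyy] with z h h'
    exact (Q.chg_apply h' h (s z)).symm
  have hA : MDifferentiableAt 𝓘(ℝ, E) 𝓘(ℝ, E' →L[ℝ] E') (Q.chg y p) y :=
    mdiff_of_smoothOn ((Q.isOpen_base y).inter (Q.isOpen_base p)) (Q.chg_smooth y p) ⟨hyy, hp⟩
  have hB : MDifferentiableAt 𝓘(ℝ, E) 𝓘(ℝ, E') (Q.tr y s) y :=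
    mdiff_of_smoothOn (hU.inter (Q.isOpen_base y)) (Q.smooth_tr hU hs y) ⟨hy, hyy⟩
  rw [mvfderiv_congr h1, mvfderiv_clm_apply hA hB, Q.mvfderiv_chg hyy hp _ hv0]
  rw [← Q.chg_apply hyy hp]
  simp only [zero_apply, zero_add]
  congr 1
  have h2 : Q.conn s y v = (trivializationAt E' Q.B y).symm y (mvfderiv 𝓘(ℝ, E) (Q.tr y s) y v) :=
    Trivialization.symmL_apply _ hyy _
  rw [h2]
  exact congrArg Prod.snd
    ((trivializationAt E' Q.B y).apply_mk_symm hyy (mvfderiv 𝓘(ℝ, E) (Q.tr y s) y v))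

theorem tr_inj {y p : P} (hp : y ∈ Q.base p) {b c : Q.B y}
    (h : (trivializationAt E' Q.B p ⟨y, b⟩).2 = (trivializationAt E' Q.B p ⟨y, c⟩).2) : b = c := by
  have hb := (trivializationAt E' Q.B p).symm_proj_apply ⟨y, b⟩ hp
  have hc := (trivializationAt E' Q.B p).symm_proj_apply ⟨y, c⟩ hp
  rw [h] at hb
  exact hb.symm.trans hc

theorem tr_add {y p : P} (hp : y ∈ Q.base p) (b c : Q.B y) :
    (trivializationAt E' Q.B p ⟨y, b + c⟩).2 =
      (trivializationAt E' Q.B p ⟨y, b⟩).2 + (trivializationAt E' Q.B p ⟨y, c⟩).2 :=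
  ((trivializationAt E' Q.B p).linear ℝ hp).1 b c

theorem tr_smul {y p : P} (hp : y ∈ Q.base p) (r : ℝ) (b : Q.B y) :
    (trivializationAt E' Q.B p ⟨y, r • b⟩).2 = r • (trivializationAt E' Q.B p ⟨y, b⟩).2 :=
  ((trivializationAt E' Q.B p).linear ℝ hp).2 r b

theorem smooth_of_tr {s : Π p, Q.B p} {U : Set P}
    (h : ∀ x ∈ U, ∃ f : P → E', ContMDiffAt 𝓘(ℝ, E) 𝓘(ℝ, E') ∞ f x ∧ ∀ᶠ y in 𝓝 x, Q.tr x s y = f y) :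
    IsSmoothSectionOn E E' Q.B s U := by
  intro x hx
  refine ContMDiffAt.contMDiffWithinAt ?_
  rw [(trivializationAt E' Q.B x).contMDiffAt_section_iff (Q.mem_base x)]
  obtain ⟨f, hf, h⟩ := h x hx
  exact hf.congr_of_eventuallyEq h

theorem smooth_tr_at {s : Π p, Q.B p} {U : Set P} (hU : IsOpen U)
    (hs : IsSmoothSectionOn E E' Q.B s U) {p : P} (hp : p ∈ U) :
    ContMDiffAt 𝓘(ℝ, E) 𝓘(ℝ, E') ∞ (Q.tr p s) p :=
  (Q.smooth_tr hU hs p).contMDiffAt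
    ((hU.inter (Q.isOpen_base p)).mem_nhds ⟨hp, Q.mem_base p⟩)

theorem conn_congr (U : Set P) (s t : Π p, Q.B p) (hU : IsOpen U) (h : ∀ x ∈ U, s x = t x)
    (x : P) (hx : x ∈ U) : Q.conn s x = Q.conn t x := by
  have h1 : Q.tr x s =ᶠ[𝓝 x] Q.tr x t := by
    filter_upwards [hU.mem_nhds hx] with y hy
    simp only [tr, h y hy]
  have h2 := mvfderiv_congr (E := E) h1
  simp only [conn]
  rw [h2]

theorem conn_add (U : Set P) (s t : Π p, Q.B p) (hU : IsOpen U)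
    (hs : IsSmoothSectionOn E E' Q.B s U) (ht : IsSmoothSectionOn E E' Q.B t U)
    (x : P) (hx : x ∈ U) : Q.conn (fun y => s y + t y) x = Q.conn s x + Q.conn t x := by
  have hst : IsSmoothSectionOn E E' Q.B (fun y => s y + t y) U :=
    Q.smooth_of_tr fun p hp => ⟨_, (Q.smooth_tr_at hU hs hp).add (Q.smooth_tr_at hU ht hp), by
      filter_upwards [(Q.isOpen_base p).mem_nhds (Q.mem_base p)] with y hy
      exact Q.tr_add hy _ _⟩
  ext v
  apply Q.tr_inj (Q.mem_base x)
  have hm := Q.mem_base x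
  rw [LinearMap.add_apply, Q.tr_add hm, Q.tr_conn hU hst hx hm, Q.tr_conn hU hs hx hm,
    Q.tr_conn hU ht hx hm]
  have h1 : Q.tr x (fun y => s y + t y) =ᶠ[𝓝 x] Q.tr x s + Q.tr x t := by
    filter_upwards [(Q.isOpen_base x).mem_nhds hm] with y hy
    exact Q.tr_add hy _ _
  rw [mvfderiv_congr h1, mvfderiv_add
    (mdiff_of_smoothOn (hU.inter (Q.isOpen_base x)) (Q.smooth_tr hU hs x) ⟨hx, hm⟩)
    (mdiff_of_smoothOn (hU.inter (Q.isOpen_base x)) (Q.smooth_tr hU ht x) ⟨hx, hm⟩)]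
  rfl

theorem conn_leibniz (U : Set P) (f : P → ℝ) (s : Π p, Q.B p) (hU : IsOpen U)
    (hf : ContMDiffOn 𝓘(ℝ, E) 𝓘(ℝ, ℝ) ∞ f U) (hs : IsSmoothSectionOn E E' Q.B s U)
    (x : P) (hx : x ∈ U) (v : Q.vert x) : Q.conn (fun y => f y • s y) x v =
      f x • Q.conn s x v + mvfderiv 𝓘(ℝ, E) f x (v : TangentSpace 𝓘(ℝ, E) x) • s x := by
  have hst : IsSmoothSectionOn E E' Q.B (fun y => f y • s y) U :=
    Q.smooth_of_tr fun p hp => ⟨_, (hf.contMDiffAt (hU.mem_nhds hp)).smul (Q.smooth_tr_at hU hs hp), by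
      filter_upwards [(Q.isOpen_base p).mem_nhds (Q.mem_base p)] with y hy
      exact Q.tr_smul hy _ _⟩
  apply Q.tr_inj (Q.mem_base x)
  have hm := Q.mem_base x
  rw [Q.tr_add hm, Q.tr_smul hm, Q.tr_smul hm, Q.tr_conn hU hst hx hm, Q.tr_conn hU hs hx hm]
  have h1 : Q.tr x (fun y => f y • s y) =ᶠ[𝓝 x] f • Q.tr x s := by
    filter_upwards [(Q.isOpen_base x).mem_nhds hm] with y hy
    exact Q.tr_smul hy _ _
  rw [mvfderiv_congr h1, mvfderiv_smul (mdiff_of_smoothOn hU hf hx)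
    (mdiff_of_smoothOn (hU.inter (Q.isOpen_base x)) (Q.smooth_tr hU hs x) ⟨hx, hm⟩)]
  rfl

theorem conn_smooth (U : Set P) (V : Π x, Q.vert x) (s : Π p, Q.B p) (hU : IsOpen U)
    (hV : IsSmoothFieldOn (fun x => (V x : TangentSpace 𝓘(ℝ, E) x)) U)
    (hs : IsSmoothSectionOn E E' Q.B s U) :
    IsSmoothSectionOn E E' Q.B (fun x => Q.conn s x (V x)) U := by
  intro x hx
  have hm := Q.mem_base x
  have hO := hU.inter (Q.isOpen_base x)
  refine ContMDiffAt.contMDiffWithinAt ?_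
  rw [(trivializationAt E' Q.B x).contMDiffAt_section_iff hm]
  have h1 := smooth_mvfderiv hO (Q.smooth_tr hU hs x) (hV.mono inter_subset_left)
  refine (h1.contMDiffAt (hO.mem_nhds ⟨hx, hm⟩)).congr_of_eventuallyEq ?_
  filter_upwards [hO.mem_nhds ⟨hx, hm⟩] with y hy
  exact Q.tr_conn hU hs hy.1 hy.2 _

theorem conn_flat [CompleteSpace E] (U : Set P) (V V' : Π x, Q.vert x) (s : Π p, Q.B p) (hU : IsOpen U)
    (hV : IsSmoothFieldOn (fun x => (V x : TangentSpace 𝓘(ℝ, E) x)) U)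
    (hV' : IsSmoothFieldOn (fun x => (V' x : TangentSpace 𝓘(ℝ, E) x)) U)
    (hs : IsSmoothSectionOn E E' Q.B s U) (x : P) (hx : x ∈ U)
    (h : VectorField.mlieBracket 𝓘(ℝ, E) (fun y => (V y : TangentSpace 𝓘(ℝ, E) y))
      (fun y => (V' y : TangentSpace 𝓘(ℝ, E) y)) x ∈ Q.vert x) :
    Q.conn (fun y => Q.conn s y (V' y)) x (V x) = Q.conn (fun y => Q.conn s y (V y)) x (V' x) +
      Q.conn s x ⟨VectorField.mlieBracket 𝓘(ℝ, E) (fun y => (V y : TangentSpace 𝓘(ℝ, E) y))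
      (fun y => (V' y : TangentSpace 𝓘(ℝ, E) y)) x, h⟩ := by
  have hm := Q.mem_base x
  have hO := hU.inter (Q.isOpen_base x)
  apply Q.tr_inj hm
  rw [Q.tr_add hm, Q.tr_conn hU (Q.conn_smooth U V' s hU hV' hs) hx hm,
    Q.tr_conn hU (Q.conn_smooth U V s hU hV hs) hx hm, Q.tr_conn hU hs hx hm,
    mvfderiv_bracket hO (Q.smooth_tr hU hs x) (hV.mono inter_subset_left)
      (hV'.mono inter_subset_left) ⟨hx, hm⟩]
  have key : ∀ V : Π x, Q.vert x, Q.tr x (fun y => Q.conn s y (V y)) =ᶠ[𝓝 x]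
      fun y => mvfderiv 𝓘(ℝ, E) (Q.tr x s) y (V y : TangentSpace 𝓘(ℝ, E) y) := by
    intro V
    filter_upwards [hO.mem_nhds ⟨hx, hm⟩] with y hy
    exact Q.tr_conn hU hs hy.1 hy.2 _
  rw [mvfderiv_congr (key V), mvfderiv_congr (key V')]
  abel

end PfaffianFibration
end RelAlg

namespace RelAlg

theorem two_le_infty : (2 : WithTop ℕ∞) ≤ ∞ := (mod_cast le_top : ((2 : ℕ∞) : WithTop ℕ∞) ≤ ∞)

theorem extDeriv_comp_fderiv {E E' : Type*} [NormedAddCommGroup E] [NormedSpace ℝ E]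
    [NormedAddCommGroup E'] [NormedSpace ℝ E'] {k : ℕ} {a : E → E' [⋀^Fin k]→L[ℝ] ℝ} {f : E → E'}
    {x : E} (ha : DifferentiableAt ℝ a x) (hf : ContDiffAt ℝ ∞ f x) (v : Fin (k + 1) → E) :
    extDeriv (fun z => (a z).compContinuousLinearMap (fderiv ℝ f z)) x v =
      ∑ i : Fin (k + 1), (-1 : ℝ) ^ (i : ℕ) *
        (fderiv ℝ a x (v i)) (fun j => fderiv ℝ f x (i.removeNth v j)) := by
  have hd2f : DifferentiableAt ℝ (fderiv ℝ f) x :=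
    (hf.fderiv_right (m := 1) (by simpa [one_add_one_eq_two] using two_le_infty)).differentiableAt
      one_ne_zero
  rw [extDeriv, fderiv_continuousAlternatingMapCompContinuousLinearMap ha hd2f,
    ContinuousAlternatingMap.alternatizeUncurryFin_add,
    ContinuousAlternatingMap.alternatizeUncurryFin_fderivCompContinuousLinearMap_eq_zero, add_zero]
  · simp [ContinuousAlternatingMap.alternatizeUncurryFin_apply, Function.comp_def]
  · exact hf.isSymmSndFDerivAt (by simpa using two_le_infty)

namespace PfaffianFibration
variable {E : Type*} [NormedAddCommGroup E] [NormedSpace ℝ E]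
  {P : Type*} [TopologicalSpace P] [ChartedSpace E P] [IsManifold 𝓘(ℝ, E) ∞ P]
  {E' : Type*} [NormedAddCommGroup E'] [NormedSpace ℝ E']
  {X : Type*} [TopologicalSpace X] [ChartedSpace E' X] [IsManifold 𝓘(ℝ, E') ∞ X]
variable (Q : PfaffianFibration E P E' X)

/-- A form on `π*TX`, read in the trivialization around `p`. -/
abbrev rd {k : ℕ} (p : P) (α : Form Q.B k) (y : P) : E' [⋀^Fin k]→L[ℝ] ℝ :=
  (α y).compContinuousLinearMap ((trivializationAt E' Q.B p).symmL ℝ y)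

/-- The projection `π`, read in the chart of `X` around `π(p)`. -/
abbrev fch (p : P) (y : P) : E' := extChartAt 𝓘(ℝ, E') (Q.proj p) (Q.proj y)

theorem proj_mem {p y : P} (hp : y ∈ Q.base p) : Q.proj y ∈ (chartAt E' (Q.proj p)).source := hp

theorem smooth_fch (p : P) : ContMDiffOn 𝓘(ℝ, E) 𝓘(ℝ, E') ∞ (Q.fch p) (Q.base p) :=
  (contMDiffOn_extChartAt (I := 𝓘(ℝ, E')) (x := Q.proj p) (n := ∞)).comp Q.proj.contMDiff.contMDiffOn
    (fun _ hy => hy)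

theorem mvfderiv_fch {p y : P} (hp : y ∈ Q.base p) (v : TangentSpace 𝓘(ℝ, E) y) :
    mvfderiv 𝓘(ℝ, E) (Q.fch p) y v =
      (trivializationAt E' Q.B p ⟨y, Q.dproj y v⟩).2 := by
  have h1 := mvfderiv_comp_vec (g := extChartAt 𝓘(ℝ, E') (Q.proj p)) (f := Q.proj)
    (mdifferentiableAt_extChartAt (Q.proj_mem hp)) (Q.proj.contMDiff.mdifferentiable (by simp) y) v
  refine h1.trans ?_
  have h2 := TangentBundle.continuousLinearMapAt_trivializationAt (I := 𝓘(ℝ, E')) (Q.proj_mem hp)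
  have h3 := congrArg (fun L : E' →L[ℝ] E' => L (mfderiv 𝓘(ℝ, E) 𝓘(ℝ, E') Q.proj y v)) h2
  refine Eq.trans h3.symm ?_
  exact Trivialization.continuousLinearMapAt_apply_of_mem ℝ (trivializationAt E' (TangentSpace 𝓘(ℝ, E') : X → Type _) (Q.proj p)) (b := Q.proj y) hp _

theorem symmL_tr {p y : P} (hp : y ∈ Q.base p) (b : Q.B y) :
    (trivializationAt E' Q.B p).symmL ℝ y (trivializationAt E' Q.B p ⟨y, b⟩).2 = b := by
  rw [Trivialization.symmL_apply _ hp]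
  exact (trivializationAt E' Q.B p).symm_proj_apply ⟨y, b⟩ hp

theorem tr_symmL {p y : P} (hp : y ∈ Q.base p) (w : E') :
    (trivializationAt E' Q.B p ⟨y, (trivializationAt E' Q.B p).symmL ℝ y w⟩).2 = w := by
  rw [Trivialization.symmL_apply _ hp]
  exact congrArg Prod.snd ((trivializationAt E' Q.B p).apply_mk_symm hp w)

theorem inclForm_apply {k : ℕ} (α : Form Q.B k) {p y : P} (hp : y ∈ Q.base p)
    (v : Fin k → TangentSpace 𝓘(ℝ, E) y) :
    Q.inclForm α y v = Q.rd p α y (fun i => mvfderiv 𝓘(ℝ, E) (Q.fch p) y (v i)) := by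
  have h : (fun i => (trivializationAt E' Q.B p).symmL ℝ y (mvfderiv 𝓘(ℝ, E) (Q.fch p) y (v i))) =
      fun i => Q.dproj y (v i) := by
    funext i
    rw [Q.mvfderiv_fch hp, Q.symmL_tr hp]
  exact (congrArg (α y) h).symm

theorem extDer_inclForm {k : ℕ} {α : Form Q.B k} {U : Set P} (hU : IsOpen U)
    (hα : IsSmoothFormOn E E' Q.B α U) {p y : P} (hy : y ∈ U) (hp : y ∈ Q.base p)
    (v : Fin (k + 1) → TangentSpace 𝓘(ℝ, E) y) :
    extDer (Q.inclForm α) y v = ∑ i : Fin (k + 1), (-1 : ℝ) ^ (i : ℕ) *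
      (mvfderiv 𝓘(ℝ, E) (Q.rd p α) y (v i))
        (fun j => mvfderiv 𝓘(ℝ, E) (Q.fch p) y (i.removeNth v j)) := by
  have hO := hU.inter (Q.isOpen_base p)
  set ψ := extChartAt 𝓘(ℝ, E) y with hψ
  have ha := hasFDerivAt_chart (mdiff_of_smoothOn hO (hα p) ⟨hy, hp⟩)
  have hf := contDiffAt_chart (Q.isOpen_base p) (Q.smooth_fch p) hp
  have hf' := hasFDerivAt_chart (mdiff_of_smoothOn (Q.isOpen_base p) (Q.smooth_fch p) hp)
  have htar : ∀ᶠ z in 𝓝 (ψ y), z ∈ ψ.target ∧ ψ.symm z ∈ Q.base p := by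
    have h1 : ψ.target ∈ 𝓝 (ψ y) := extChartAt_target_mem_nhds (I := 𝓘(ℝ, E)) y
    have h2 : ContinuousAt ψ.symm (ψ y) := continuousAt_extChartAt_symm y
    have h3 : ψ.symm (ψ y) = y := extChartAt_to_inv y
    filter_upwards [h1, h2.preimage_mem_nhds (by rw [h3]; exact (Q.isOpen_base p).mem_nhds hp)]
      with z h h'
    exact ⟨h, h'⟩
  have heq : (fun z : E => ((Q.inclForm α (ψ.symm z)).compContinuousLinearMap
      (mfderiv 𝓘(ℝ, E) 𝓘(ℝ, E) ψ.symm z) : E [⋀^Fin k]→L[ℝ] ℝ)) =ᶠ[𝓝 (ψ y)]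
      fun z => (Q.rd p α (ψ.symm z)).compContinuousLinearMap
        (fderiv ℝ (fun z => Q.fch p (ψ.symm z)) z) := by
    filter_upwards [htar] with z hz
    ext w
    have h1 := fderiv_chart_symm hz.1 (mdiff_of_smoothOn (Q.isOpen_base p) (Q.smooth_fch p) hz.2)
    have h2 := Q.inclForm_apply α hz.2 (fun i => mfderiv 𝓘(ℝ, E) 𝓘(ℝ, E) ψ.symm z (w i))
    refine Eq.trans h2 ?_
    rw [h1.fderiv]
    rfl
  have h1 := extDeriv_comp_fderiv ha.differentiableAt hf v
  rw [ha.fderiv, hf'.fderiv] at h1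
  refine Eq.trans ?_ h1
  rw [← heq.extDeriv_eq]
  have h0 : ∀ u : E, mfderiv 𝓘(ℝ, E) 𝓘(ℝ, E) ψ y u = u := fun u => by
      rw [mfderiv_extChartAt_self]; rfl
  have h2 : (fun i => mfderiv 𝓘(ℝ, E) 𝓘(ℝ, E) ψ y (v i)) = v := funext fun i => h0 (v i)
  exact congrArg (extDeriv (fun z : E => ((Q.inclForm α (ψ.symm z)).compContinuousLinearMap
      (mfderiv 𝓘(ℝ, E) 𝓘(ℝ, E) ψ.symm z) : E [⋀^Fin k]→L[ℝ] ℝ)) (ψ y)) h2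
 
end PfaffianFibration
end RelAlg

namespace RelAlg
section WedgeAlg
open Equiv Equiv.Perm

/-- The sign of a permutation as a real number. -/
abbrev sgn {n : ℕ} (σ : Perm (Fin n)) : ℝ := ((Perm.sign σ : ℤ) : ℝ)

theorem sgn_mul {n : ℕ} (σ τ : Perm (Fin n)) : sgn (σ * τ) = sgn σ * sgn τ := by
  simp [sgn, Perm.sign_mul]

theorem sgn_sq {n : ℕ} (σ : Perm (Fin n)) : sgn σ * sgn σ = 1 := by
  rcases Int.units_eq_one_or (Perm.sign σ) with h | h <;> simp [sgn, h]

theorem sum_mul_right {n : ℕ} (ρ : Perm (Fin n)) (F : Perm (Fin n) → ℝ) :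
    ∑ σ, sgn σ * F (σ * ρ) = sgn ρ * ∑ σ, sgn σ * F σ := by
  rw [← Equiv.sum_comp (Equiv.mulRight ρ) (fun σ => sgn σ * F σ), Finset.mul_sum]
  refine Finset.sum_congr rfl fun σ _ => ?_
  simp only [Equiv.coe_mulRight, sgn_mul]
  linear_combination (-(sgn σ * F (σ * ρ))) * sgn_sq ρ

/-- If `F (σ * ι τ)` are averaged over a subgroup acting by `ι`, nothing changes. -/
theorem sum_sum_mul {n m : ℕ} (j : Perm (Fin m) → Perm (Fin n)) (hj : ∀ τ, sgn (j τ) = sgn τ)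
    (F : Perm (Fin n) → ℝ) :
    ∑ σ, sgn σ * ∑ τ, sgn τ * F (σ * j τ) = (m.factorial : ℝ) * ∑ σ, sgn σ * F σ := by
  simp only [Finset.mul_sum]
  rw [Finset.sum_comm]
  have : ∀ τ : Perm (Fin m), ∑ σ, sgn σ * (sgn τ * F (σ * j τ)) = ∑ σ, sgn σ * F σ := by
    intro τ
    have h := sum_mul_right (j τ) F
    rw [hj] at h
    calc ∑ σ, sgn σ * (sgn τ * F (σ * j τ)) = sgn τ * ∑ σ, sgn σ * F (σ * j τ) := by
          rw [Finset.mul_sum]; exact Finset.sum_congr rfl fun σ _ => by ring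
      _ = _ := by rw [h, ← mul_assoc, sgn_sq, one_mul]
  rw [Finset.sum_congr rfl fun τ _ => this τ, Finset.sum_const, Finset.card_univ, Fintype.card_perm,
    Fintype.card_fin, nsmul_eq_mul, Finset.mul_sum]

variable {V : Type*} [NormedAddCommGroup V] [NormedSpace ℝ V]

theorem sum_perm_alt {n : ℕ} (h : V [⋀^Fin n]→L[ℝ] ℝ) (v : Fin n → V) :
    ∑ σ : Perm (Fin n), sgn σ * h (fun i => v (σ i)) = (n.factorial : ℝ) * h v := by
  have : ∀ σ : Perm (Fin n), sgn σ * h (fun i => v (σ i)) = h v := by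
    intro σ
    have h1 := h.toAlternatingMap.map_perm v σ
    have h2 : h (fun i => v (σ i)) = sgn σ * h v := by
      refine Eq.trans h1 ?_
      simp [Units.smul_def]
    rw [h2, ← mul_assoc, sgn_sq, one_mul]
  rw [Finset.sum_congr rfl fun τ _ => this τ, Finset.sum_const, Finset.card_univ, Fintype.card_perm,
    Fintype.card_fin, nsmul_eq_mul]

open ContinuousAlternatingMap in
theorem altUF_eq {n : ℕ} (g : V →L[ℝ] V [⋀^Fin n]→L[ℝ] ℝ) (v : Fin (n + 1) → V) :
    (n.factorial : ℝ) * alternatizeUncurryFin g v =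
      ∑ σ : Perm (Fin (n + 1)), sgn σ * g (v (σ 0)) (fun j => v (σ j.succ)) := by
  have h1 := sum_perm_alt (alternatizeUncurryFin g) v
  simp only [alternatizeUncurryFin_apply] at h1
  have h2 : ∀ i : Fin (n + 1), ∑ σ : Perm (Fin (n + 1)), sgn σ * ((-1 : ℝ) ^ (i : ℕ) *
      g (v (σ i)) (fun j => v (σ (i.succAbove j)))) =
      ∑ σ : Perm (Fin (n + 1)), sgn σ * g (v (σ 0)) (fun j => v (σ j.succ)) := by
    intro i
    have h := sum_mul_right i.cycleRange
      (fun σ => g (v (σ i)) (fun j => v (σ (i.succAbove j))))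
    simp only [Perm.mul_apply, Fin.cycleRange_self, Fin.cycleRange_succAbove] at h
    rw [h, Finset.mul_sum]
    refine Finset.sum_congr rfl fun σ _ => ?_
    simp only [sgn, Fin.sign_cycleRange]
    push_cast
    ring
  have h3 : ∑ σ : Perm (Fin (n + 1)), sgn σ * ∑ i : Fin (n + 1), ((-1 : ℝ) ^ (i : ℕ) *
      g (v (σ i)) (fun j => v (σ (i.succAbove j)))) = ((n + 1 : ℕ) : ℝ) *
      ∑ σ : Perm (Fin (n + 1)), sgn σ * g (v (σ 0)) (fun j => v (σ j.succ)) := by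
    simp only [Finset.mul_sum _ _ (sgn _)]
    rw [Finset.sum_comm, Finset.sum_congr rfl fun i _ => h2 i, Finset.sum_const, Finset.card_univ,
      Fintype.card_fin, nsmul_eq_mul]
  have h4 : ((n + 1 : ℕ) : ℝ) ≠ 0 := by positivity
  apply mul_left_cancel₀ h4
  rw [← h3, ← mul_assoc, ← Nat.cast_mul, ← Nat.factorial_succ, ← sum_perm_alt]
  refine Finset.sum_congr rfl fun σ _ => ?_
  rw [alternatizeUncurryFin_apply]
  congr 1
  refine Finset.sum_congr rfl fun i _ => ?_
  simp
  rfl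

/-- Permutations of the tail. -/
theorem sum_tail {n : ℕ} (F : (Fin (n + 1) → Fin (n + 1)) → ℝ) (H : (Fin (n + 1) → Fin (n + 1)) → ℝ)
    (h : ∀ σ : Perm (Fin (n + 1)), F σ = ∑ τ : Perm (Fin n), sgn τ *
      H (Fin.cons (σ 0) fun j => σ (τ j).succ)) :
    ∑ σ : Perm (Fin (n + 1)), sgn σ * F σ =
      (n.factorial : ℝ) * ∑ σ : Perm (Fin (n + 1)), sgn σ * H σ := by
  rw [← sum_sum_mul (fun τ : Perm (Fin n) => decomposeFin.symm ((0 : Fin (n + 1)), τ))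
    (fun τ => by simp [sgn]) (fun σ => H σ)]
  refine Finset.sum_congr rfl fun σ _ => ?_
  rw [h σ]
  congr 1
  refine Finset.sum_congr rfl fun τ _ => ?_
  congr 2
  funext j
  refine Fin.cases ?_ (fun j => ?_) j <;> simp

/-- The permutation acting by `τ` on the first `k` and by `τ'` on the last `l` letters. -/
def blk {k l : ℕ} (τ : Perm (Fin k)) (τ' : Perm (Fin l)) : Perm (Fin (k + l)) :=
  finSumFinEquiv.permCongr (Perm.sumCongr τ τ')

theorem blk_left {k l : ℕ} (τ : Perm (Fin k)) (τ' : Perm (Fin l)) (i : Fin k) :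
    blk τ τ' (Fin.castAdd l i) = Fin.castAdd l (τ i) := by
  simp [blk, Equiv.permCongr_apply]

theorem blk_right {k l : ℕ} (τ : Perm (Fin k)) (τ' : Perm (Fin l)) (i : Fin l) :
    blk τ τ' (Fin.natAdd k i) = Fin.natAdd k (τ' i) := by
  simp [blk, Equiv.permCongr_apply]

theorem sgn_blk {k l : ℕ} (τ : Perm (Fin k)) (τ' : Perm (Fin l)) :
    sgn (blk τ τ') = sgn τ * sgn τ' := by
  simp [sgn, blk, sign_permCongr, sign_sumCongr]

open ContinuousAlternatingMap in
theorem wedge_altUF_left {k l : ℕ} (A : V →L[ℝ] V [⋀^Fin k]→L[ℝ] ℝ) (b : V [⋀^Fin l]→L[ℝ] ℝ)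
    (v : Fin (k + l + 1) → V) (hc : k + 1 + l = k + l + 1) :
    ((k.factorial : ℝ) * (l.factorial : ℝ)) *
      wedge (alternatizeUncurryFin A) b (v ∘ Fin.cast hc) =
    ∑ σ : Perm (Fin (k + l + 1)), sgn σ * (A (v (σ 0)) (fun i => v (σ (Fin.castAdd l i).succ)) *
      b (fun j => v (σ (Fin.natAdd k j).succ))) := by
  have hk : (k.factorial : ℝ) ≠ 0 := by positivity
  have hl : (l.factorial : ℝ) ≠ 0 := by positivity
  have hk1 : ((k + 1).factorial : ℝ) ≠ 0 := by positivity
  set u := v ∘ Fin.cast hc with hu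
  have h1 := sum_sum_mul (fun τ : Perm (Fin (k + 1)) => blk τ (1 : Perm (Fin l)))
    (fun τ => by rw [sgn_blk]; simp)
    (fun σ => A (u (σ (Fin.castAdd l 0))) (fun i => u (σ (Fin.castAdd l i.succ))) *
      b (fun j => u (σ (Fin.natAdd (k + 1) j))))
  simp only [Perm.mul_apply, blk_left, blk_right, Perm.one_apply] at h1
  have h2 : (k.factorial : ℝ) * (((k + 1).factorial : ℝ) * (l.factorial : ℝ) *
      wedge (alternatizeUncurryFin A) b u) = ((k + 1).factorial : ℝ) *
      ∑ σ : Perm (Fin (k + 1 + l)), sgn σ * (A (u (σ (Fin.castAdd l 0)))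
        (fun i => u (σ (Fin.castAdd l i.succ))) * b (fun j => u (σ (Fin.natAdd (k + 1) j)))) := by
    rw [← h1, wedge_apply, mul_inv_cancel_left₀ (mul_ne_zero hk1 hl), Finset.mul_sum]
    refine Finset.sum_congr rfl fun σ _ => ?_
    have h3 := altUF_eq A (fun i => u (σ (Fin.castAdd l i)))
    calc _ = sgn σ * (((k.factorial : ℝ) *
          alternatizeUncurryFin A (fun i => u (σ (Fin.castAdd l i)))) *
          b (fun j => u (σ (Fin.natAdd (k + 1) j)))) := by ring
      _ = _ := by
        rw [h3, Finset.sum_mul]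
        simp only [mul_assoc]
  have h3 : (k.factorial : ℝ) * (l.factorial : ℝ) * wedge (alternatizeUncurryFin A) b u =
      ∑ σ : Perm (Fin (k + 1 + l)), sgn σ * (A (u (σ (Fin.castAdd l 0)))
        (fun i => u (σ (Fin.castAdd l i.succ))) * b (fun j => u (σ (Fin.natAdd (k + 1) j)))) := by
    apply mul_left_cancel₀ hk1
    rw [← h2]; ring
  rw [h3, ← Equiv.sum_comp (finCongr hc).permCongr]
  refine Finset.sum_congr rfl fun σ _ => ?_
  have e0 : (finCongr hc).symm 0 = Fin.castAdd l 0 := by ext; simp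
  have e1 : ∀ i : Fin k, (finCongr hc).symm (Fin.castAdd l i).succ = Fin.castAdd l i.succ := by
    intro i; ext; simp
  have e2 : ∀ i : Fin l, (finCongr hc).symm (Fin.natAdd k i).succ = Fin.natAdd (k + 1) i := by
    intro i; ext; simp; omega
  simp only [sgn, sign_permCongr, Equiv.permCongr_apply, e0, e1, e2]
  rfl

open ContinuousAlternatingMap in
theorem wedge_altUF_right {k l : ℕ} (a : V [⋀^Fin k]→L[ℝ] ℝ) (B : V →L[ℝ] V [⋀^Fin l]→L[ℝ] ℝ)
    (v : Fin (k + l + 1) → V) :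
    ((k.factorial : ℝ) * (l.factorial : ℝ)) *
      ((-1) ^ k * wedge a (alternatizeUncurryFin B) v) =
    ∑ σ : Perm (Fin (k + l + 1)), sgn σ * (a (fun i => v (σ (Fin.castAdd l i).succ)) *
      B (v (σ 0)) (fun j => v (σ (Fin.natAdd k j).succ))) := by
  have hk : (k.factorial : ℝ) ≠ 0 := by positivity
  have hl : (l.factorial : ℝ) ≠ 0 := by positivity
  have hl1 : ((l + 1).factorial : ℝ) ≠ 0 := by positivity
  let F : Perm (Fin (k + (l + 1))) → ℝ := fun σ => a (fun i => v (σ (Fin.castAdd (l + 1) i))) *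
      B (v (σ (Fin.natAdd k 0))) (fun j => v (σ (Fin.natAdd k j.succ)))
  have h1 := sum_sum_mul (fun τ : Perm (Fin (l + 1)) => blk (1 : Perm (Fin k)) τ)
    (fun τ => by rw [sgn_blk]; simp) F
  simp only [F, Perm.mul_apply, blk_left, blk_right, Perm.one_apply] at h1
  have h2 : (l.factorial : ℝ) * ((k.factorial : ℝ) * ((l + 1).factorial : ℝ) *
      wedge a (alternatizeUncurryFin B) v) = ((l + 1).factorial : ℝ) *
      ∑ σ : Perm (Fin (k + (l + 1))), sgn σ * F σ := by
    rw [← h1, wedge_apply, mul_inv_cancel_left₀ (mul_ne_zero hk hl1), Finset.mul_sum]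
    refine Finset.sum_congr rfl fun σ _ => ?_
    have h3 := altUF_eq B (fun i => v (σ (Fin.natAdd k i)))
    calc _ = sgn σ * (a (fun i => v (σ (Fin.castAdd (l + 1) i))) * ((l.factorial : ℝ) *
          alternatizeUncurryFin B (fun i => v (σ (Fin.natAdd k i))))) := by ring
      _ = _ := by
        rw [h3, Finset.mul_sum]
        congr 1
        refine Finset.sum_congr rfl fun τ _ => ?_
        ring
  have h3 : (k.factorial : ℝ) * (l.factorial : ℝ) * wedge a (alternatizeUncurryFin B) v =
      ∑ σ : Perm (Fin (k + (l + 1))), sgn σ * F σ := by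
    apply mul_left_cancel₀ hl1
    rw [← h2]; ring
  have h4 := sum_mul_right (Fin.natAdd k (0 : Fin (l + 1))).cycleRange F
  have hs : sgn (Fin.natAdd k (0 : Fin (l + 1))).cycleRange = (-1) ^ k := by
    simp [sgn, Fin.sign_cycleRange]
  rw [hs, ← h3] at h4
  rw [mul_left_comm, ← h4]
  refine Finset.sum_congr rfl fun σ _ => ?_
  have e0 : (Fin.natAdd k (0 : Fin (l + 1))).cycleRange (Fin.natAdd k 0) = (0 : Fin (k + l + 1)) :=
    Fin.cycleRange_self (n := k + (l + 1)) (Fin.natAdd k (0 : Fin (l + 1)))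
  have e1 : ∀ i : Fin k, (Fin.natAdd k (0 : Fin (l + 1))).cycleRange (Fin.castAdd (l + 1) i) =
      (Fin.castAdd l i).succ := by
    intro i
    have := Fin.cycleRange_of_lt (n := k + (l + 1)) (j := Fin.natAdd k (0 : Fin (l + 1)))
      (i := Fin.castAdd (l + 1) i) (by simp [Fin.lt_def])
    refine this.trans ?_
    ext
    rw [Fin.val_add_one_of_lt' (by simp; omega)]
    simp
  have e2 : ∀ i : Fin l, (Fin.natAdd k (0 : Fin (l + 1))).cycleRange (Fin.natAdd k i.succ) =
      (Fin.natAdd k i).succ := by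
    intro i
    have := Fin.cycleRange_of_gt (n := k + (l + 1)) (i := Fin.natAdd k (0 : Fin (l + 1)))
      (j := Fin.natAdd k i.succ) (by simp [Fin.lt_def])
    refine this.trans ?_
    ext
    simp; omega
  simp only [F, Perm.mul_apply, e0, e1, e2]

open ContinuousAlternatingMap in
theorem altUF_wedge {k l : ℕ} {a : V [⋀^Fin k]→L[ℝ] ℝ} {b : V [⋀^Fin l]→L[ℝ] ℝ}
    {A : V →L[ℝ] V [⋀^Fin k]→L[ℝ] ℝ} {B : V →L[ℝ] V [⋀^Fin l]→L[ℝ] ℝ}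
    {g : V →L[ℝ] V [⋀^Fin (k + l)]→L[ℝ] ℝ}
    (hg : ∀ w u, g w u = wedge (A w) b u + wedge a (B w) u)
    (v : Fin (k + l + 1) → V) (hc : k + 1 + l = k + l + 1) :
    alternatizeUncurryFin g v = wedge (alternatizeUncurryFin A) b (v ∘ Fin.cast hc) +
      (-1) ^ k * wedge a (alternatizeUncurryFin B) v := by
  have hk : (k.factorial : ℝ) ≠ 0 := by positivity
  have hl : (l.factorial : ℝ) ≠ 0 := by positivity
  have hkl : ((k + l).factorial : ℝ) ≠ 0 := by positivity
  apply mul_left_cancel₀ (mul_ne_zero hk hl)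
  rw [mul_add, wedge_altUF_left, wedge_altUF_right]
  apply mul_left_cancel₀ hkl
  have h := sum_tail (fun s => (k.factorial : ℝ) * (l.factorial : ℝ) *
      g (v (s 0)) (fun j => v (s j.succ)))
      (fun s => A (v (s 0)) (fun i => v (s (Fin.castAdd l i).succ)) *
        b (fun j => v (s (Fin.natAdd k j).succ)) + a (fun i => v (s (Fin.castAdd l i).succ)) *
        B (v (s 0)) (fun j => v (s (Fin.natAdd k j).succ))) (fun σ => by
      rw [hg, wedge_apply, wedge_apply, ← mul_add, mul_inv_cancel_left₀ (mul_ne_zero hk hl),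
        ← Finset.sum_add_distrib]
      refine Finset.sum_congr rfl fun τ _ => ?_
      simp only [Fin.cons_zero, Fin.cons_succ, mul_add])
  rw [mul_left_comm, altUF_eq, ← Finset.sum_add_distrib, Finset.mul_sum]
  simp only [← mul_add]
  rw [← h]
  refine Finset.sum_congr rfl fun τ _ => ?_
  ring

theorem wedge_add_left {k l : ℕ} (a a' : V [⋀^Fin k]→L[ℝ] ℝ) (b : V [⋀^Fin l]→L[ℝ] ℝ) :
    wedge (a + a') b = wedge a b + wedge a' b := by
  ext v
  rw [ContinuousAlternatingMap.add_apply, wedge_apply, wedge_apply, wedge_apply, ← mul_add,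
    ← Finset.sum_add_distrib]
  congr 1
  exact Finset.sum_congr rfl fun σ _ => by rw [ContinuousAlternatingMap.add_apply]; ring

theorem wedge_add_right {k l : ℕ} (a : V [⋀^Fin k]→L[ℝ] ℝ) (b b' : V [⋀^Fin l]→L[ℝ] ℝ) :
    wedge a (b + b') = wedge a b + wedge a b' := by
  ext v
  rw [ContinuousAlternatingMap.add_apply, wedge_apply, wedge_apply, wedge_apply, ← mul_add,
    ← Finset.sum_add_distrib]
  congr 1
  exact Finset.sum_congr rfl fun σ _ => by rw [ContinuousAlternatingMap.add_apply]; ring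

theorem wedge_smul_left {k l : ℕ} (c : ℝ) (a : V [⋀^Fin k]→L[ℝ] ℝ) (b : V [⋀^Fin l]→L[ℝ] ℝ) :
    wedge (c • a) b = c • wedge a b := by
  ext v
  rw [ContinuousAlternatingMap.smul_apply, wedge_apply, wedge_apply, smul_eq_mul, mul_left_comm,
    Finset.mul_sum _ _ c]
  congr 1
  exact Finset.sum_congr rfl fun σ _ => by rw [ContinuousAlternatingMap.smul_apply, smul_eq_mul]; ring

theorem wedge_smul_right {k l : ℕ} (c : ℝ) (a : V [⋀^Fin k]→L[ℝ] ℝ) (b : V [⋀^Fin l]→L[ℝ] ℝ) :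
    wedge a (c • b) = c • wedge a b := by
  ext v
  rw [ContinuousAlternatingMap.smul_apply, wedge_apply, wedge_apply, smul_eq_mul, mul_left_comm,
    Finset.mul_sum _ _ c]
  congr 1
  exact Finset.sum_congr rfl fun σ _ => by rw [ContinuousAlternatingMap.smul_apply, smul_eq_mul]; ring

theorem norm_wedge_le {k l : ℕ} (a : V [⋀^Fin k]→L[ℝ] ℝ) (b : V [⋀^Fin l]→L[ℝ] ℝ) :
    ‖wedge a b‖ ≤ (((k.factorial : ℝ) * (l.factorial : ℝ))⁻¹ * ((k + l).factorial : ℝ)) * ‖a‖ * ‖b‖ := by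
  refine ContinuousAlternatingMap.opNorm_le_bound _ (by positivity) fun v => ?_
  rw [wedge_apply, norm_mul, Real.norm_of_nonneg (by positivity), mul_assoc, mul_assoc, mul_assoc]
  refine mul_le_mul_of_nonneg_left ?_ (by positivity)
  refine (norm_sum_le _ _).trans ?_
  have : ∀ σ : Perm (Fin (k + l)), ‖sgn σ * (a (fun i => v (σ (Fin.castAdd l i))) *
      b (fun j => v (σ (Fin.natAdd k j))))‖ ≤ ‖a‖ * ‖b‖ * ∏ i, ‖v i‖ := by
    intro σ
    have h1 : ‖sgn σ‖ = 1 := by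
      rcases Int.units_eq_one_or (Perm.sign σ) with h | h <;> simp [sgn, h]
    rw [norm_mul, norm_mul, h1, one_mul, ← Equiv.prod_comp σ, Fin.prod_univ_add]
    calc _ ≤ (‖a‖ * ∏ i, ‖v (σ (Fin.castAdd l i))‖) * (‖b‖ * ∏ i, ‖v (σ (Fin.natAdd k i))‖) :=
          mul_le_mul (a.le_opNorm _) (b.le_opNorm _) (norm_nonneg _) (by positivity)
      _ = _ := by ring
  refine (Finset.sum_le_sum fun σ _ => this σ).trans ?_
  rw [Finset.sum_const, Finset.card_univ, Fintype.card_perm, Fintype.card_fin, nsmul_eq_mul]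
  exact le_of_eq (by ring)

theorem isBoundedBilinearMap_wedge (k l : ℕ) : IsBoundedBilinearMap ℝ
    (fun p : (V [⋀^Fin k]→L[ℝ] ℝ) × (V [⋀^Fin l]→L[ℝ] ℝ) => wedge p.1 p.2) where
  add_left a a' b := wedge_add_left a a' b
  smul_left c a b := wedge_smul_left c a b
  add_right a b b' := wedge_add_right a b b'
  smul_right c a b := wedge_smul_right c a b
  bound := ⟨((k.factorial : ℝ) * (l.factorial : ℝ))⁻¹ * ((k + l).factorial : ℝ), by positivity,
    norm_wedge_le⟩

theorem wedge_comp {V' V : Type*} [AddCommMonoid V] [Module ℝ V] [TopologicalSpace V]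
    [AddCommMonoid V'] [Module ℝ V'] [TopologicalSpace V'] {k l : ℕ}
    (a : V [⋀^Fin k]→L[ℝ] ℝ) (b : V [⋀^Fin l]→L[ℝ] ℝ) (L : V' →L[ℝ] V) :
    (wedge a b).compContinuousLinearMap L =
      wedge (a.compContinuousLinearMap L) (b.compContinuousLinearMap L) := by
  ext v
  rw [ContinuousAlternatingMap.compContinuousLinearMap_apply, wedge_apply, wedge_apply]
  rfl
end WedgeAlg
end RelAlg

namespace RelAlg

section Calc3
variable {E : Type*} [NormedAddCommGroup E] [NormedSpace ℝ E]
  {M : Type*} [TopologicalSpace M] [ChartedSpace E M]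
  {G : Type*} [NormedAddCommGroup G] [NormedSpace ℝ G]
  {G' : Type*} [NormedAddCommGroup G'] [NormedSpace ℝ G']
  {G'' : Type*} [NormedAddCommGroup G''] [NormedSpace ℝ G'']

theorem mdiff_comp {b : G → G'} (hb : ContDiff ℝ ∞ b) {h : M → G} {p : M}
    (hh : MDifferentiableAt 𝓘(ℝ, E) 𝓘(ℝ, G) h p) :
    MDifferentiableAt 𝓘(ℝ, E) 𝓘(ℝ, G') (fun y => b (h y)) p :=
  ((hb.contMDiff.mdifferentiable (by simp)) (h p)).comp p hh

theorem mvfderiv_clm (L : G →L[ℝ] G') {h : M → G} {p : M}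
    (hh : MDifferentiableAt 𝓘(ℝ, E) 𝓘(ℝ, G) h p) (v : TangentSpace 𝓘(ℝ, E) p) :
    mvfderiv 𝓘(ℝ, E) (fun y => L (h y)) p v = L (mvfderiv 𝓘(ℝ, E) h p v) := by
  have h1 := L.hasFDerivAt.comp _ (hasFDerivAt_chart hh)
  have h2 := hasFDerivAt_chart (mdiff_comp L.contDiff hh)
  exact congrArg (fun L : E →L[ℝ] G' => L v) (h2.unique h1)

theorem mvfderiv_bilin {b : G × G' → G''} (hb : IsBoundedBilinearMap ℝ b) {h : M → G} {h' : M → G'}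
    {p : M} (hh : MDifferentiableAt 𝓘(ℝ, E) 𝓘(ℝ, G) h p)
    (hh' : MDifferentiableAt 𝓘(ℝ, E) 𝓘(ℝ, G') h' p) (v : TangentSpace 𝓘(ℝ, E) p) :
    mvfderiv 𝓘(ℝ, E) (fun y => b (h y, h' y)) p v =
      b (mvfderiv 𝓘(ℝ, E) h p v, h' p) + b (h p, mvfderiv 𝓘(ℝ, E) h' p v) := by
  have h1 := (hb.hasFDerivAt _).comp _ ((hasFDerivAt_chart hh).prodMk (hasFDerivAt_chart hh'))
  have h2 := hasFDerivAt_chart (mdiff_comp hb.contDiff (hh.prodMk_space hh'))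
  refine (congrArg (fun L : E →L[ℝ] G'' => L v) (h2.unique h1)).trans ?_
  have h0 : (extChartAt 𝓘(ℝ, E) p).symm (extChartAt 𝓘(ℝ, E) p p) = p := extChartAt_to_inv p
  rw [h0]
  exact add_comm _ _

theorem smooth_smulRight {c : M → G →L[ℝ] ℝ} {h : M → G'} {q : M}
    (hc : ContMDiffAt 𝓘(ℝ, E) 𝓘(ℝ, G →L[ℝ] ℝ) ∞ c q) (hh : ContMDiffAt 𝓘(ℝ, E) 𝓘(ℝ, G') ∞ h q) :
    ContMDiffAt 𝓘(ℝ, E) 𝓘(ℝ, G →L[ℝ] G') ∞ (fun y => (c y).smulRight (h y)) q :=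
  (isBoundedBilinearMap_smulRight (𝕜 := ℝ) (E := G) (F := G')).contDiff.contMDiff.contMDiffAt.comp q
    (hc.prodMk_space hh)
end Calc3

namespace PfaffianFibration
variable {E : Type*} [NormedAddCommGroup E] [NormedSpace ℝ E]
  {P : Type*} [TopologicalSpace P] [ChartedSpace E P] [IsManifold 𝓘(ℝ, E) ∞ P]
  {E' : Type*} [NormedAddCommGroup E'] [NormedSpace ℝ E']
  {X : Type*} [TopologicalSpace X] [ChartedSpace E' X] [IsManifold 𝓘(ℝ, E') ∞ X]
variable (Q : PfaffianFibration E P E' X)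

/-- The bundle `π*TX` with the foliation `C ∩ ker Tπ` and the canonical flat connection. -/
def flatBundle [FiniteDimensional ℝ E] : FlatFoliatedBundle E E' Q.B :=
  haveI : CompleteSpace E := FiniteDimensional.complete ℝ E
  { fol := Q.vert
    fol_isDistribution := Q.vert_isDistribution
    fol_isInvolutive := Q.vert_isInvolutive
    conn := Q.conn
    conn_congr := Q.conn_congr
    conn_add := Q.conn_add
    conn_leibniz := Q.conn_leibniz
    conn_smooth := Q.conn_smooth
    flat := fun U V V' s hU hV hV' hs x hx => Q.conn_flat U V V' s hU hV hV' hs x hx _ }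

theorem rd_vert [FiniteDimensional ℝ E] {k : ℕ} {α : Form Q.B k} {U : Set P} (hU : IsOpen U)
    (hα : Q.flatBundle.IsFlatFormOn α U) {p y : P} (hy : y ∈ U) (hp : y ∈ Q.base p)
    (v : Q.vert y) : mvfderiv 𝓘(ℝ, E) (Q.rd p α) y (v : TangentSpace 𝓘(ℝ, E) y) = 0 := by
  have hd := mdiff_of_smoothOn (hU.inter (Q.isOpen_base p)) (hα.smooth p) ⟨hy, hp⟩
  ext w
  let b : Fin k → Π z, Q.B z := fun i z => (trivializationAt E' Q.B p).symmL ℝ z (w i)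
  have htr : ∀ i, ∀ z ∈ Q.base p, Q.tr p (b i) z = w i := fun i z hz => Q.tr_symmL hz (w i)
  have hb : ∀ i, IsSmoothSectionOn E E' Q.B (b i) (Q.base p) := fun i =>
    ((trivializationAt E' Q.B p).contMDiffOn_section_iff (Q.isOpen_base p) subset_rfl).2
      (contMDiffOn_const.congr (htr i))
  have h0 := hα.flat y hy v (Q.base p) b (Q.isOpen_base p) hp hb
  have hc : ∀ i, Q.conn (b i) y v = 0 := by
    intro i
    apply Q.tr_inj hp
    rw [Q.tr_conn (Q.isOpen_base p) (hb i) hp hp v]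
    have h1 : Q.tr p (b i) =ᶠ[𝓝 y] fun _ => w i := by
      filter_upwards [(Q.isOpen_base p).mem_nhds hp] with z hz using htr i z hz
    have h2 := Q.tr_smul hp 0 (0 : Q.B y)
    rw [zero_smul, zero_smul] at h2
    rw [mvfderiv_congr h1, h2]
    have h3 := mfderiv_const (I := 𝓘(ℝ, E)) (I' := 𝓘(ℝ, E')) (x := y) (c := w i)
    exact congrArg (fun L : E →L[ℝ] E' => L (v : TangentSpace 𝓘(ℝ, E) y)) h3
  have h1 := mvfderiv_clm (ContinuousAlternatingMap.apply ℝ E' ℝ w) hd v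
  refine Eq.trans h1.symm ?_
  have h2 : ∑ i, α y (Function.update (fun j => b j y) i (Q.conn (b i) y v)) = 0 := by
    refine Finset.sum_eq_zero fun i _ => ?_
    rw [hc i]
    exact (α y).toMultilinearMap.map_update_zero _ _
  have h3 : mvfderiv 𝓘(ℝ, E) (fun z => α z fun i => b i z) y (v : TangentSpace 𝓘(ℝ, E) y) -
    ∑ i, α y (Function.update (fun j => b j y) i (Q.conn (b i) y v)) = 0 := h0
  rw [h2, sub_zero] at h3
  exact h3

variable [FiniteDimensional ℝ E']

theorem lift_mem (y : P) (b : Q.B y) : Q.lift y b ∈ Q.C y := (Q.exists_lift y).choose_spec.1 b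
theorem dproj_lift (y : P) (b : Q.B y) : Q.dproj y (Q.lift y b) = b :=
  (Q.exists_lift y).choose_spec.2 b

/-- The chosen lift, in a trivialization. -/
abbrev lft (p y : P) : E' →L[ℝ] TangentSpace 𝓘(ℝ, E) y :=
  Q.lift y ∘L (trivializationAt E' Q.B p).symmL ℝ y

theorem fch_lft {p y : P} (hp : y ∈ Q.base p) (w : E') :
    mvfderiv 𝓘(ℝ, E) (Q.fch p) y (Q.lft p y w) = w := by
  rw [Q.mvfderiv_fch hp]
  simp only [lft, ContinuousLinearMap.comp_apply, dproj_lift]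
  exact Q.tr_symmL hp w

theorem rd_D_lift {k : ℕ} {α : Form Q.B k} {U : Set P} (hU : IsOpen U)
    (hα : IsSmoothFormOn E E' Q.B α U) {p y : P} (hy : y ∈ U) (hp : y ∈ Q.base p) :
    Q.rd p (Q.D α) y = ContinuousAlternatingMap.alternatizeUncurryFin
      (mvfderiv 𝓘(ℝ, E) (Q.rd p α) y ∘L Q.lft p y) := by
  ext w
  have h := Q.extDer_inclForm hU hα hy hp (fun i => Q.lft p y (w i))
  refine Eq.trans h ?_
  rw [ContinuousAlternatingMap.alternatizeUncurryFin_apply]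
  refine Finset.sum_congr rfl fun i _ => ?_
  have h1 : (fun j => mvfderiv 𝓘(ℝ, E) (Q.fch p) y
      (i.removeNth (fun i => Q.lft p y (w i)) j)) = i.removeNth w :=
    funext fun j => Q.fch_lft hp _
  rw [h1]
  simp

theorem rd_inj {k : ℕ} {p y : P} (hp : y ∈ Q.base p) {a a' : Q.B y [⋀^Fin k]→L[ℝ] ℝ}
    (h : a.compContinuousLinearMap ((trivializationAt E' Q.B p).symmL ℝ y) =
      a'.compContinuousLinearMap ((trivializationAt E' Q.B p).symmL ℝ y)) : a = a' := by
  ext b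
  have h1 := congrArg (fun c : E' [⋀^Fin k]→L[ℝ] ℝ =>
    c (fun i => (trivializationAt E' Q.B p ⟨y, b i⟩).2)) h
  have h2 : (fun i => (trivializationAt E' Q.B p).symmL ℝ y (trivializationAt E' Q.B p ⟨y, b i⟩).2) = b :=
    funext fun i => Q.symmL_tr hp (b i)
  change a (fun i => (trivializationAt E' Q.B p).symmL ℝ y (trivializationAt E' Q.B p ⟨y, b i⟩).2) =
    a' (fun i => (trivializationAt E' Q.B p).symmL ℝ y (trivializationAt E' Q.B p ⟨y, b i⟩).2) at h1
  rwa [h2] at h1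

theorem D_congr {k : ℕ} (U : Set P) (α β : Form Q.B k) (hU : IsOpen U)
    (h : ∀ x ∈ U, α x = β x) (x : P) (hx : x ∈ U) : Q.D α x = Q.D β x := by
  have h0 : ∀ᶠ z in 𝓝 (extChartAt 𝓘(ℝ, E) x x), (extChartAt 𝓘(ℝ, E) x).symm z ∈ U := by
    have h2 : ContinuousAt (extChartAt 𝓘(ℝ, E) x).symm (extChartAt 𝓘(ℝ, E) x x) :=
      continuousAt_extChartAt_symm x
    exact h2.preimage_mem_nhds (by rw [extChartAt_to_inv]; exact hU.mem_nhds hx)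
  have h1 : extDer (Q.inclForm α) x = extDer (Q.inclForm β) x := by
    have : (fun z : E => ((Q.inclForm α ((extChartAt 𝓘(ℝ, E) x).symm z)).compContinuousLinearMap
        (mfderiv 𝓘(ℝ, E) 𝓘(ℝ, E) (extChartAt 𝓘(ℝ, E) x).symm z) : E [⋀^Fin k]→L[ℝ] ℝ))
        =ᶠ[𝓝 (extChartAt 𝓘(ℝ, E) x x)]
        (fun z : E => ((Q.inclForm β ((extChartAt 𝓘(ℝ, E) x).symm z)).compContinuousLinearMap
        (mfderiv 𝓘(ℝ, E) 𝓘(ℝ, E) (extChartAt 𝓘(ℝ, E) x).symm z) : E [⋀^Fin k]→L[ℝ] ℝ)) := by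
      filter_upwards [h0] with z hz
      simp only [inclForm, h _ hz]
    simp only [extDer]
    rw [this.extDeriv_eq]
  simp only [D, h1]

theorem smooth_form_add {k : ℕ} {U : Set P} {α β : Form Q.B k} (hα : IsSmoothFormOn E E' Q.B α U)
    (hβ : IsSmoothFormOn E E' Q.B β U) : IsSmoothFormOn E E' Q.B (fun y => α y + β y) U :=
  fun p => (hα p).add (hβ p)

theorem D_add {k : ℕ} (U : Set P) (α β : Form Q.B k) (hU : IsOpen U)
    (hα : IsSmoothFormOn E E' Q.B α U) (hβ : IsSmoothFormOn E E' Q.B β U) (x : P) (hx : x ∈ U) :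
    Q.D (fun y => α y + β y) x = Q.D α x + Q.D β x := by
  have hm := Q.mem_base x
  have hO := hU.inter (Q.isOpen_base x)
  have h1 := Q.rd_D_lift hU hα hx hm
  have h2 := Q.rd_D_lift hU hβ hx hm
  have h3 := Q.rd_D_lift hU (Q.smooth_form_add hα hβ) hx hm
  apply Q.rd_inj hm
  refine h3.trans ((?_ : _ = _).trans (congrArg₂ (· + ·) h1 h2).symm)
  simp only [← ContinuousAlternatingMap.alternatizeUncurryFin_add]
  congr 1
  ext1 w
  exact congrArg (fun L : E →L[ℝ] _ => L (Q.lft x x w)) (mfderiv_add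
    (mdiff_of_smoothOn hO (hα x) ⟨hx, hm⟩) (mdiff_of_smoothOn hO (hβ x) ⟨hx, hm⟩))

theorem D_smul {k : ℕ} (U : Set P) (c : ℝ) (α : Form Q.B k) (hU : IsOpen U)
    (hα : IsSmoothFormOn E E' Q.B α U) (x : P) (hx : x ∈ U) :
    Q.D (fun y => c • α y) x = c • Q.D α x := by
  have hm := Q.mem_base x
  have hO := hU.inter (Q.isOpen_base x)
  have hs : IsSmoothFormOn E E' Q.B (fun y => c • α y) U := fun p =>
    (c • ContinuousLinearMap.id ℝ (E' [⋀^Fin k]→L[ℝ] ℝ)).contDiff.contMDiff.comp_contMDiffOn (hα p)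
  have h1 := Q.rd_D_lift hU hα hx hm
  have h3 := Q.rd_D_lift hU hs hx hm
  apply Q.rd_inj hm
  refine h3.trans ((?_ : _ = _).trans (congrArg (c • ·) h1).symm)
  simp only [← ContinuousAlternatingMap.alternatizeUncurryFin_smul]
  congr 1
  ext1 w
  exact mvfderiv_clm (c • ContinuousLinearMap.id ℝ (E' [⋀^Fin k]→L[ℝ] ℝ))
    (mdiff_of_smoothOn hO (hα x) ⟨hx, hm⟩) (Q.lft x x w)

theorem D_leibniz {k l : ℕ} (U : Set P) (α : Form Q.B k) (β : Form Q.B l) (hU : IsOpen U)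
    (hα : IsSmoothFormOn E E' Q.B α U) (hβ : IsSmoothFormOn E E' Q.B β U) (x : P) (hx : x ∈ U)
    (w : Fin (k + l + 1) → Q.B x) (hc : k + 1 + l = k + l + 1) :
    Q.D (fun y => wedge (α y) (β y)) x w =
      wedge (Q.D α x) (β x) (w ∘ Fin.cast hc) + (-1) ^ k * wedge (α x) (Q.D β x) w := by
  have hm := Q.mem_base x
  have hO := hU.inter (Q.isOpen_base x)
  have hr : ∀ p, Q.rd p (fun y => wedge (α y) (β y)) = fun y => wedge (Q.rd p α y) (Q.rd p β y) :=
    fun p => funext fun y => wedge_comp _ _ _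
  have hs : IsSmoothFormOn E E' Q.B (fun y => wedge (α y) (β y)) U := by
    intro p
    have := (isBoundedBilinearMap_wedge (V := E') k l).contDiff (n := ∞) |>.contMDiff.comp_contMDiffOn
      ((hα p).prodMk_space (hβ p))
    exact this.congr fun y _ => congrFun (hr p) y
  have h1 := Q.rd_D_lift hU hα hx hm
  have h2 := Q.rd_D_lift hU hβ hx hm
  have h3 := Q.rd_D_lift hU hs hx hm
  set e := trivializationAt E' Q.B x
  let t : ∀ {n : ℕ}, (Fin n → Q.B x) → Fin n → E' := fun b i => (e ⟨x, b i⟩).2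
  have ht : ∀ {n : ℕ} (a : Q.B x [⋀^Fin n]→L[ℝ] ℝ) (b : Fin n → Q.B x),
      a b = a.compContinuousLinearMap (e.symmL ℝ x) (t b) := by
    intro n a b
    have : (fun i => e.symmL ℝ x (t b i)) = b := funext fun i => Q.symmL_tr hm (b i)
    exact (congrArg a this).symm
  rw [ht, ht (wedge (Q.D α x) (β x)), ht (wedge (α x) (Q.D β x)), wedge_comp, wedge_comp]
  change Q.rd x _ x _ = wedge (Q.rd x _ x) (Q.rd x β x) _ + _ * wedge (Q.rd x α x) (Q.rd x _ x) _
  rw [h1, h2, h3]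
  refine altUF_wedge ?_ (t w) hc
  intro u u'
  have h4 := mvfderiv_bilin (isBoundedBilinearMap_wedge (V := E') k l)
    (mdiff_of_smoothOn hO (hα x) ⟨hx, hm⟩) (mdiff_of_smoothOn hO (hβ x) ⟨hx, hm⟩) (Q.lft x x u)
  rw [hr x]
  exact congrArg (fun c : E' [⋀^Fin (k + l)]→L[ℝ] ℝ => c u') h4

theorem rd_D [FiniteDimensional ℝ E] {k : ℕ} {α : Form Q.B k} {U : Set P} (hU : IsOpen U)
    (hα : Q.flatBundle.IsFlatFormOn α U) {p y : P} (hy : y ∈ U) (hp : y ∈ Q.base p)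
    (L : E' →L[ℝ] TangentSpace 𝓘(ℝ, E) y) (hL : ∀ w, L w ∈ Q.C y)
    (hL' : ∀ w, mvfderiv 𝓘(ℝ, E) (Q.fch p) y (L w) = w) :
    Q.rd p (Q.D α) y = ContinuousAlternatingMap.alternatizeUncurryFin
      (mvfderiv 𝓘(ℝ, E) (Q.rd p α) y ∘L L) := by
  rw [Q.rd_D_lift hU hα.smooth hy hp]
  congr 1
  ext1 w
  have hv : Q.lft p y w - L w ∈ Q.vert y := by
    refine ⟨Submodule.sub_mem _ (Q.lift_mem y _) (hL w), ?_⟩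
    have h1 : mvfderiv 𝓘(ℝ, E) (Q.fch p) y (Q.lft p y w - L w) = 0 := by
      rw [map_sub, Q.fch_lft hp, hL', sub_self]
    rw [Q.mvfderiv_fch hp] at h1
    have h2 := Q.tr_smul hp 0 (0 : Q.B y)
    rw [zero_smul, zero_smul] at h2
    exact Q.tr_inj hp (h1.trans h2.symm)
  have := Q.rd_vert hU hα hy hp ⟨_, hv⟩
  simp only [map_sub] at this
  exact sub_eq_zero.1 this

theorem D_smooth [FiniteDimensional ℝ E] {k : ℕ} (U : Set P) (α : Form Q.B k) (hU : IsOpen U)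
    (hα : Q.flatBundle.IsFlatFormOn α U) : IsSmoothFormOn E E' Q.B (Q.D α) U := by
  have : CompleteSpace E' := FiniteDimensional.complete ℝ E'
  intro p q hq
  refine ContMDiffAt.contMDiffWithinAt ?_
  obtain ⟨O, hO, hqO, r, e, he, hspan⟩ := Q.isDistribution q
  have hOb := (hU.inter hO).inter (Q.isOpen_base p)
  set N := (U ∩ O) ∩ Q.base p with hN
  have hqN : q ∈ N := ⟨⟨hq.1, hqO⟩, hq.2⟩
  let M : P → (Fin r → ℝ) →L[ℝ] E' := fun y => ∑ i, (ContinuousLinearMap.proj i).smulRight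
    (mvfderiv 𝓘(ℝ, E) (Q.fch p) y (e i y))
  have hei : ∀ i, IsSmoothFieldOn (e i) N := fun i => (he i).mono fun y hy => hy.1.2
  have hM : ContMDiffOn 𝓘(ℝ, E) 𝓘(ℝ, (Fin r → ℝ) →L[ℝ] E') ∞ M N := by
    refine contMDiffOn_finsetSum fun i _ => ?_
    have h1 := smooth_mvfderiv hOb ((Q.smooth_fch p).mono fun y hy => hy.2) (hei i)
    exact (ContinuousLinearMap.smulRightL ℝ (Fin r → ℝ) E'
      (ContinuousLinearMap.proj i)).contDiff.contMDiff.comp_contMDiffOn h1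
  have hMsum : ∀ y (c : Fin r → ℝ), M y c = mvfderiv 𝓘(ℝ, E) (Q.fch p) y (∑ i, c i • e i y) := by
    intro y c
    rw [map_sum]
    simp [M]
  have hsurj : Function.Surjective (M q) := by
    intro w
    have h1 : Q.lft p q w ∈ Submodule.span ℝ (range fun i => e i q) := by
      rw [(hspan q hqO).2]; exact Q.lift_mem q _
    obtain ⟨c, hc⟩ := (Submodule.mem_span_range_iff_exists_fun ℝ).1 h1
    refine ⟨c, ?_⟩
    rw [hMsum, hc]
    exact Q.fch_lft hq.2 w
  obtain ⟨g, hg⟩ := (M q).toLinearMap.exists_rightInverse_of_surjective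
    (LinearMap.range_eq_top.2 hsurj)
  let Lq : E' →L[ℝ] (Fin r → ℝ) := LinearMap.toContinuousLinearMap g
  let S : P → E' →L[ℝ] E' := fun y => M y ∘L Lq
  have hSq : S q = 1 := by
    ext w
    exact LinearMap.congr_fun hg w
  have hS : ContMDiffOn 𝓘(ℝ, E) 𝓘(ℝ, E' →L[ℝ] E') ∞ S N := hM.clm_comp contMDiffOn_const
  have hSat := hS.contMDiffAt (hOb.mem_nhds hqN)
  let Λ : P → E' →L[ℝ] (Fin r → ℝ) := fun y => Lq ∘L Ring.inverse (S y)
  have hΛ : ContMDiffAt 𝓘(ℝ, E) 𝓘(ℝ, E' →L[ℝ] (Fin r → ℝ)) ∞ Λ q := by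
    refine contMDiffAt_const.clm_comp ?_
    have h1 : ContDiffAt ℝ ∞ Ring.inverse (S q) := by
      rw [hSq]; exact contDiffAt_ringInverse ℝ (1 : (E' →L[ℝ] E')ˣ)
    exact h1.contMDiffAt.comp q hSat
  have hunit : ∀ᶠ y in 𝓝 q, IsUnit (S y) := by
    refine hSat.continuousAt.preimage_mem_nhds (Units.isOpen.mem_nhds ?_)
    change IsUnit (S q)
    rw [hSq]; exact isUnit_one
  let T : P → E' →L[ℝ] E' [⋀^Fin k]→L[ℝ] ℝ := fun y => ∑ i,
    (ContinuousLinearMap.proj i ∘L Λ y).smulRight (mvfderiv 𝓘(ℝ, E) (Q.rd p α) y (e i y))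
  have hT : ContMDiffAt 𝓘(ℝ, E) 𝓘(ℝ, E' →L[ℝ] E' [⋀^Fin k]→L[ℝ] ℝ) ∞ T q := by
    refine contMDiffAt_finsetSum fun i _ => ?_
    have h1 := (smooth_mvfderiv hOb ((hα.smooth p).mono fun y hy => ⟨hy.1.1, hy.2⟩)
      (hei i)).contMDiffAt (hOb.mem_nhds hqN)
    have h2 : ContMDiffAt 𝓘(ℝ, E) 𝓘(ℝ, E' →L[ℝ] ℝ) ∞
        (fun y => (ContinuousLinearMap.proj i : (Fin r → ℝ) →L[ℝ] ℝ) ∘L Λ y) q :=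
      contMDiffAt_const.clm_comp hΛ
    exact smooth_smulRight h2 h1
  have hfin : ContMDiffAt 𝓘(ℝ, E) 𝓘(ℝ, E' [⋀^Fin (k + 1)]→L[ℝ] ℝ) ∞
      (fun y => ContinuousAlternatingMap.alternatizeUncurryFin (T y)) q :=
    (ContinuousAlternatingMap.alternatizeUncurryFinCLM ℝ E' ℝ (n := k)).contDiff.contMDiff.contMDiffAt.comp q hT
  refine hfin.congr_of_eventuallyEq ?_
  filter_upwards [hunit, hOb.mem_nhds hqN] with y hy hyN
  let L : E' →L[ℝ] TangentSpace 𝓘(ℝ, E) y :=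
    ∑ i, (ContinuousLinearMap.proj i ∘L Λ y).smulRight (e i y)
  have hLw : ∀ w, L w = ∑ i, Λ y w i • e i y := by
    intro w
    simp [L]
  have h1 := Q.rd_D hU hα hyN.1.1 hyN.2 L (fun w => ?_) (fun w => ?_)
  · refine h1.trans ?_
    congr 1
    ext1 w
    rw [ContinuousLinearMap.comp_apply, hLw, map_sum]
    simp [T]
  · rw [hLw, ← (hspan y hyN.1.2).2]
    exact Submodule.sum_mem _ fun i _ => Submodule.smul_mem _ _ (Submodule.subset_span ⟨i, rfl⟩)
  · rw [hLw, ← hMsum]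
    exact congrArg (fun L : E' →L[ℝ] E' => L w) (Ring.mul_inverse_cancel (S y) hy)

/-- The relative algebroid underlying a Pfaffian fibration. -/
def relativeAlgebroid [FiniteDimensional ℝ E] : RelativeAlgebroid E E' Q.B where
  toFlatFoliatedBundle := Q.flatBundle
  D := Q.D
  D_congr := Q.D_congr
  D_smooth := Q.D_smooth
  D_add U α β hU hα hβ := Q.D_add U α β hU hα.smooth hβ.smooth
  D_smul U c α hU hα := Q.D_smul U c α hU hα.smooth
  D_leibniz U α β hU hα hβ x hx w := Q.D_leibniz U α β hU hα.smooth hβ.smooth x hx w _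

end PfaffianFibration
end RelAlg

namespace RelAlg
namespace PfaffianFibration
section Pull
variable {E : Type*} [NormedAddCommGroup E] [NormedSpace ℝ E]
  {P : Type*} [TopologicalSpace P] [ChartedSpace E P] [IsManifold 𝓘(ℝ, E) ∞ P]
  {E' : Type*} [NormedAddCommGroup E'] [NormedSpace ℝ E']
  {X : Type*} [TopologicalSpace X] [ChartedSpace E' X] [IsManifold 𝓘(ℝ, E') ∞ X]
variable (Q : PfaffianFibration E P E' X)

/-- The characterizing property of the connection: `∇_v π*Z = 0` for (local) vector fields `Z` on the base. -/
theorem conn_pullback (O : Set X) (hO : IsOpen O) (Z : Π x : X, TangentSpace 𝓘(ℝ, E') x)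
    (hZ : IsSmoothFieldOn Z O) (p : P) (hp : Q.proj p ∈ O) (v : Q.vert p) :
    Q.conn (fun q => (Z (Q.proj q) : TangentSpace 𝓘(ℝ, E') (Q.proj q))) p v = 0 := by
  let e := trivializationAt E' (TangentSpace 𝓘(ℝ, E') : X → Type _) (Q.proj p)
  have hm : Q.proj p ∈ e.baseSet := FiberBundle.mem_baseSet_trivializationAt' (Q.proj p)
  have h1 := (e.contMDiffOn_section_iff (hO.inter e.open_baseSet) inter_subset_right).1
    (hZ.mono inter_subset_left)
  have h2 := mvfderiv_comp_vec (g := fun x => (e ⟨x, Z x⟩).2) (f := Q.proj)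
    (mdiff_of_smoothOn (hO.inter e.open_baseSet) h1 ⟨hp, hm⟩)
    (Q.proj.contMDiff.mdifferentiable (by simp) p) (v : TangentSpace 𝓘(ℝ, E) p)
  have hv : mfderiv 𝓘(ℝ, E) 𝓘(ℝ, E') Q.proj p (v : TangentSpace 𝓘(ℝ, E) p) = 0 := v.2.2
  rw [hv, map_zero] at h2
  have h3 : Q.conn (fun q => (Z (Q.proj q) : TangentSpace 𝓘(ℝ, E') (Q.proj q))) p v =
    (trivializationAt E' Q.B p).symmL ℝ p (mvfderiv 𝓘(ℝ, E) (fun y => (e ⟨Q.proj y, Z (Q.proj y)⟩).2) p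
      (v : TangentSpace 𝓘(ℝ, E) p)) := rfl
  rw [h3, h2, map_zero]
end Pull

section Hom
variable {E₁ : Type*} [NormedAddCommGroup E₁] [NormedSpace ℝ E₁]
  {P₁ : Type*} [TopologicalSpace P₁] [ChartedSpace E₁ P₁] [IsManifold 𝓘(ℝ, E₁) ∞ P₁]
  {E₁' : Type*} [NormedAddCommGroup E₁'] [NormedSpace ℝ E₁']
  {X₁ : Type*} [TopologicalSpace X₁] [ChartedSpace E₁' X₁] [IsManifold 𝓘(ℝ, E₁') ∞ X₁]
  {E₂ : Type*} [NormedAddCommGroup E₂] [NormedSpace ℝ E₂]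
  {P₂ : Type*} [TopologicalSpace P₂] [ChartedSpace E₂ P₂] [IsManifold 𝓘(ℝ, E₂) ∞ P₂]
  {E₂' : Type*} [NormedAddCommGroup E₂'] [NormedSpace ℝ E₂']
  {X₂ : Type*} [TopologicalSpace X₂] [ChartedSpace E₂' X₂] [IsManifold 𝓘(ℝ, E₂') ∞ X₂]

/-- A morphism of Pfaffian fibrations: smooth maps `Φ : P₁ → P₂` and `φ : X₁ → X₂` with
`π₂ ∘ Φ = φ ∘ π₁` and `TΦ(C₁) ⊆ C₂`. -/
structure Hom (Q₁ : PfaffianFibration E₁ P₁ E₁' X₁) (Q₂ : PfaffianFibration E₂ P₂ E₂' X₂) where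
  Φ : ContMDiffMap 𝓘(ℝ, E₁) 𝓘(ℝ, E₂) P₁ P₂ ∞
  φ : ContMDiffMap 𝓘(ℝ, E₁') 𝓘(ℝ, E₂') X₁ X₂ ∞
  comm : ∀ p, Q₂.proj (Φ p) = φ (Q₁.proj p)
  map_C : ∀ (p : P₁) (v : TangentSpace 𝓘(ℝ, E₁) p), v ∈ Q₁.C p →
    mfderiv 𝓘(ℝ, E₁) 𝓘(ℝ, E₂) Φ p v ∈ Q₂.C (Φ p)

/-- The canonical bundle map `Φ_* : π₁*TX₁ → π₂*TX₂` over `Φ`. On the fibre over `p` it is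
`T_{π₁(p)}φ : T_{π₁(p)}X₁ → T_{φ(π₁(p))}X₂`, whose target is the fibre `T_{π₂(Φ(p))}X₂` of `π₂*TX₂`
over `Φ(p)` because `π₂(Φ(p)) = φ(π₁(p))`. (In Mathlib both tangent spaces are the model space `E₂'`, so that
no transport along this equality of points has to be written.) -/
def Hom.bundleMap {Q₁ : PfaffianFibration E₁ P₁ E₁' X₁} {Q₂ : PfaffianFibration E₂ P₂ E₂' X₂}
    (f : Hom Q₁ Q₂) (p : P₁) : Q₁.B p →L[ℝ] Q₂.B (f.Φ p) :=
  mfderiv 𝓘(ℝ, E₁') 𝓘(ℝ, E₂') f.φ (Q₁.proj p)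
end Hom
end PfaffianFibration
end RelAlg

end

noncomputable section

set_option linter.unusedSectionVars false

/-! Everything rests on differentiating `π₂ ∘ Φ = φ ∘ π₁`: the chain rule gives `Φ_* ∘ Tπ₁ = Tπ₂ ∘
TΦ` (`bundleMap_dproj`). Together with `TΦ(C₁) ⊆ C₂` this sends `C₁ ∩ ker Tπ₁` into `C₂ ∩ ker Tπ₂`
(`map_vert`), so the foliations correspond.

Connections. In a trivialization of `π*TX` pulled back from a chart of `X`, the canonical connection
differentiates components, and the induced connection on forms differentiates the local expression
`rd` of the form (`covForm_eq`). In such trivializations `Φ_*` is the matrix `dφ ∘ π₁`, which is a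
function pulled back from `X₁` and so has zero derivative along `ker Tπ₁` (`mvfderiv_dφ_proj`).
Differentiating the local expression of `Φ*α` in a direction of the foliation therefore gives only
the derivative of `α` along `TΦ(v)`, with no term from the matrix (`mvfderiv_rd_pullbackForm`).
Compatibility with the connections and preservation of flat forms both follow.

Derivations. By the chain rule again, `(Φ*α) ∘ Tπ₁` is the ordinary pullback by `Φ` of the
differential form `α ∘ Tπ₂`, and `d` commutes with pullback (`extDer_inclForm_pullbackForm`). For
lifts `cᵢ ∈ C₁` of `bᵢ`, the vectors `TΦ(cᵢ)` lie in `C₂` and project to `Φ_*(bᵢ)`. They need not be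
the lifts chosen in the definition of `D`, but for flat `α` the value of `d(α ∘ Tπ₂)` on vectors of
`C₂` depends only on their projections (`extDer_inclForm_congr`). Hence `Φ*(D₂α) = D₁(Φ*α)`.

The rest is calculus: product rules for alternating maps with varying arguments, smooth dependence
of pullbacks, and a formula for `d` of forms `a(df, …, df)`. -/

namespace RelAlg

/-! ### Smooth dependence of pullbacks of alternating maps -/

section AlternatingCalculus

variable {V V' : Type*} [NormedAddCommGroup V] [NormedSpace ℝ V]
  [NormedAddCommGroup V'] [NormedSpace ℝ V']

/-- Antisymmetrization of continuous multilinear maps, as a continuous linear map. -/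
def alternatizationCLM (V : Type*) [NormedAddCommGroup V] [NormedSpace ℝ V] (k : ℕ) :
    ContinuousMultilinearMap ℝ (fun _ : Fin k => V) ℝ →L[ℝ] V [⋀^Fin k]→L[ℝ] ℝ :=
  LinearMap.mkContinuous
    { toFun := fun m => ContinuousMultilinearMap.alternatization m
      map_add' := fun m m' => map_add _ m m'
      map_smul' := fun c m => by
        ext v
        simp [ContinuousMultilinearMap.alternatization_apply_apply, Finset.mul_sum,
          Units.smul_def, mul_left_comm] }
    -- The bound is the number of permutations: each summand is at most `‖m‖ * ∏ i, ‖v i‖`, since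
    -- permuting the arguments only reorders the product.
    (k.factorial : ℝ) fun m => by
      refine ContinuousAlternatingMap.opNorm_le_bound _ (by positivity) fun v => ?_
      change ‖ContinuousMultilinearMap.alternatization m v‖ ≤ _
      rw [ContinuousMultilinearMap.alternatization_apply_apply]
      refine (norm_sum_le _ _).trans ?_
      have h : ∀ σ : Equiv.Perm (Fin k),
          ‖Equiv.Perm.sign σ • m (v ∘ σ)‖ ≤ ‖m‖ * ∏ i, ‖v i‖ := by
        intro σ
        have h1 : ‖Equiv.Perm.sign σ • m (v ∘ σ)‖ = ‖m (v ∘ σ)‖ := by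
          rcases Int.units_eq_one_or (Equiv.Perm.sign σ) with h | h <;> simp [h]
        rw [h1, ← Equiv.prod_comp σ]
        exact m.le_opNorm _
      refine (Finset.sum_le_sum fun σ _ => h σ).trans ?_
      rw [Finset.sum_const, Finset.card_univ, Fintype.card_perm, Fintype.card_fin, nsmul_eq_mul,
        mul_assoc]

theorem alternatizationCLM_apply {k : ℕ}
    (m : ContinuousMultilinearMap ℝ (fun _ : Fin k => V) ℝ) (v : Fin k → V) :
    alternatizationCLM V k m v = ∑ σ : Equiv.Perm (Fin k), sgn σ * m (fun i => v (σ i)) := by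
  refine (ContinuousMultilinearMap.alternatization_apply_apply m v).trans ?_
  simp [Units.smul_def, Function.comp_def]

/-- The pullback of an alternating map along a linear map depends smoothly on both. -/
theorem contDiff_compContinuousLinearMap (k : ℕ) :
    ContDiff ℝ ∞ (fun p : (V [⋀^Fin k]→L[ℝ] ℝ) × (V' →L[ℝ] V) =>
      p.1.compContinuousLinearMap p.2) := by
  have h1 : ContDiff ℝ ∞ (fun p : (V [⋀^Fin k]→L[ℝ] ℝ) × (V' →L[ℝ] V) =>
      (p.1.toContinuousMultilinearMap).compContinuousLinearMap (fun _ : Fin k => p.2)) := by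
    have hc : ContDiff ℝ ∞ (fun q : (Fin k → V' →L[ℝ] V) ×
        ContinuousMultilinearMap ℝ (fun _ : Fin k => V) ℝ => q.2.compContinuousLinearMap q.1) := by
      rw [contDiff_iff_contDiffAt]
      exact fun q =>
        (ContinuousMultilinearMap.cpolynomialAt_uncurry_compContinuousLinearMap).analyticAt.contDiffAt
    refine hc.comp (ContDiff.prodMk ?_ ?_)
    · exact contDiff_pi.2 fun _ => contDiff_snd
    · exact (ContinuousAlternatingMap.toContinuousMultilinearMapLI (𝕜 := ℝ) (E := V) (F := ℝ)
        (ι := Fin k)).contDiff.comp contDiff_fst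
  -- Antisymmetrizing a map that is already alternating multiplies it by `k!`. Dividing by `k!` thus
  -- recovers the alternating pullback from the multilinear one, and smoothness passes from
  -- multilinear to alternating maps along a continuous linear map.
  have h2 := (alternatizationCLM V' k).contDiff.comp h1 |>.const_smul ((k.factorial : ℝ)⁻¹)
  convert h2 using 1
  funext p
  ext v
  have h3 := sum_perm_alt (p.1.compContinuousLinearMap p.2) v
  change _ = (k.factorial : ℝ)⁻¹ • (alternatizationCLM V' k _ v)
  rw [alternatizationCLM_apply, smul_eq_mul, eq_inv_mul_iff_mul_eq₀ (by positivity)]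
  exact h3.symm

end AlternatingCalculus

/-! ### Product rules and the exterior derivative on a manifold -/

section ManifoldCalculus

variable {E : Type*} [NormedAddCommGroup E] [NormedSpace ℝ E]
  {M : Type*} [TopologicalSpace M] [ChartedSpace E M]
  {G : Type*} [NormedAddCommGroup G] [NormedSpace ℝ G]
  {G' : Type*} [NormedAddCommGroup G'] [NormedSpace ℝ G']

/-- Product rule for a multilinear pairing. The sum on the right has the shape of the correction
subtracted in `covForm`, so the two cancel in a trivialization. -/
theorem mvfderiv_alternating_apply {k : ℕ} {a : M → G [⋀^Fin k]→L[ℝ] ℝ} {g : Fin k → M → G} {p : M}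
    (ha : ContMDiffAt 𝓘(ℝ, E) 𝓘(ℝ, G [⋀^Fin k]→L[ℝ] ℝ) ∞ a p)
    (hg : ∀ i, ContMDiffAt 𝓘(ℝ, E) 𝓘(ℝ, G) ∞ (g i) p)
    (v : TangentSpace 𝓘(ℝ, E) p) :
    mvfderiv 𝓘(ℝ, E) (fun y => a y fun i => g i y) p v =
      mvfderiv 𝓘(ℝ, E) a p v (fun i => g i p) +
        ∑ i, a p (Function.update (fun j => g j p) i (mvfderiv 𝓘(ℝ, E) (g i) p v)) := by
  have hga := (contMDiffAt_pi_space.2 hg).mdifferentiableAt (by simp)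
  replace ha := ha.mdifferentiableAt (by simp)
  replace hg := fun i => (hg i).mdifferentiableAt (by simp)
  have h1 := fderiv_continuousAlternatingMap_apply_apply (hasFDerivAt_chart ha).differentiableAt
    (fun i => (hasFDerivAt_chart (hg i)).differentiableAt) v
  have h0 : (extChartAt 𝓘(ℝ, E) p).symm (extChartAt 𝓘(ℝ, E) p p) = p := extChartAt_to_inv p
  simp only [(hasFDerivAt_chart ha).fderiv, (hasFDerivAt_chart (hg _)).fderiv, h0] at h1
  -- `mvfderiv` agrees with the derivative in a chart only once the composite is known to be
  -- differentiable on `M`; joint differentiability of evaluation supplies this.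
  have hev : DifferentiableAt ℝ (fun q : (G [⋀^Fin k]→L[ℝ] ℝ) × (Fin k → G) => q.1 fun i => q.2 i)
      (a p, fun i => g i p) :=
    differentiableAt_fst.continuousAlternatingMap_apply fun i =>
      ((ContinuousLinearMap.proj i).comp
        (ContinuousLinearMap.snd ℝ (G [⋀^Fin k]→L[ℝ] ℝ) (Fin k → G))).differentiableAt
  have hag := hev.mdifferentiableAt.comp p (ha.prodMk_space hga)
  exact (congrArg (fun L : E →L[ℝ] ℝ => L v) (hasFDerivAt_chart hag).fderiv.symm).trans h1

theorem smooth_comp_clm {k : ℕ} {a : M → G' [⋀^Fin k]→L[ℝ] ℝ} {L : M → G →L[ℝ] G'} {p : M}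
    (ha : ContMDiffAt 𝓘(ℝ, E) 𝓘(ℝ, G' [⋀^Fin k]→L[ℝ] ℝ) ∞ a p)
    (hL : ContMDiffAt 𝓘(ℝ, E) 𝓘(ℝ, G →L[ℝ] G') ∞ L p) :
    ContMDiffAt 𝓘(ℝ, E) 𝓘(ℝ, G [⋀^Fin k]→L[ℝ] ℝ) ∞
      (fun y => (a y).compContinuousLinearMap (L y)) p :=
  (contDiff_compContinuousLinearMap (V := G') (V' := G) k).contMDiff.contMDiffAt.comp p
    (ha.prodMk_space hL)

/-- The derivative of a pulled back alternating map in a direction in which the linear map along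
which it is pulled back is constant to first order. -/
theorem mvfderiv_comp_clm {k : ℕ} {a : M → G' [⋀^Fin k]→L[ℝ] ℝ} {L : M → G →L[ℝ] G'} {p : M}
    (ha : ContMDiffAt 𝓘(ℝ, E) 𝓘(ℝ, G' [⋀^Fin k]→L[ℝ] ℝ) ∞ a p)
    (hL : ContMDiffAt 𝓘(ℝ, E) 𝓘(ℝ, G →L[ℝ] G') ∞ L p)
    (v : TangentSpace 𝓘(ℝ, E) p) (hv : mvfderiv 𝓘(ℝ, E) L p v = 0) :
    mvfderiv 𝓘(ℝ, E) (fun y => (a y).compContinuousLinearMap (L y)) p v =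
      (mvfderiv 𝓘(ℝ, E) a p v).compContinuousLinearMap (L p) := by
  have h1 := (hasFDerivAt_chart (ha.mdifferentiableAt (by simp)
    )).continuousAlternatingMapCompContinuousLinearMap
      (hasFDerivAt_chart (hL.mdifferentiableAt (by simp)))
  have h2 := hasFDerivAt_chart ((smooth_comp_clm ha hL).mdifferentiableAt (by simp))
  refine (congrArg (fun A : E →L[ℝ] G [⋀^Fin k]→L[ℝ] ℝ => A v) (h2.unique h1)).trans ?_
  have h0 : (extChartAt 𝓘(ℝ, E) p).symm (extChartAt 𝓘(ℝ, E) p p) = p := extChartAt_to_inv p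
  simp only [h0]
  have hadd : ∀ A B : E →L[ℝ] G [⋀^Fin k]→L[ℝ] ℝ, (A + B) v = A v + B v := fun _ _ => rfl
  refine (hadd _ _).trans (Eq.trans (congrArg₂ (· + ·) rfl ?_) (add_zero _))
  -- This is the part of the product rule in which `L` is differentiated; it is linear in the
  -- derivative of `L` along `v`, which vanishes by `hv`.
  exact (congrArg ((a p).fderivCompContinuousLinearMap (L p)) hv).trans (map_zero _)

/-- With a finite basis of `G`, the operator `A y` is the finite sum of its columns `A y (b i)`
tensored with the constant coordinate functionals, so smooth columns make a smooth operator. -/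
theorem smooth_clm_of_apply [FiniteDimensional ℝ G] {A : M → G →L[ℝ] G'} {U : Set M}
    (h : ∀ w, ContMDiffOn 𝓘(ℝ, E) 𝓘(ℝ, G') ∞ (fun y => A y w) U) :
    ContMDiffOn 𝓘(ℝ, E) 𝓘(ℝ, G →L[ℝ] G') ∞ A U := by
  let b := Module.finBasis ℝ G
  have h1 : ContMDiffOn 𝓘(ℝ, E) 𝓘(ℝ, G →L[ℝ] G') ∞
      (fun y => ∑ i, (LinearMap.toContinuousLinearMap (b.coord i)).smulRight (A y (b i))) U :=
    contMDiffOn_finsetSum fun i _ =>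
      (ContinuousLinearMap.smulRightL ℝ G G'
        (LinearMap.toContinuousLinearMap (b.coord i))).contDiff.contMDiff.comp_contMDiffOn (h (b i))
  refine h1.congr fun y _ => ?_
  ext w
  conv_lhs => rw [← b.sum_repr w, map_sum]
  simp

/-- The exterior derivative of a form `a(df, …, df)`, with `a` a function with values in alternating
maps. -/
theorem extDer_of_comp_mvfderiv [IsManifold 𝓘(ℝ, E) ∞ M] {k : ℕ}
    {η : Form (TangentSpace 𝓘(ℝ, E) : M → Type _) k} {a : M → G [⋀^Fin k]→L[ℝ] ℝ} {f : M → G}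
    {U : Set M} (hU : IsOpen U) (ha : ContMDiffOn 𝓘(ℝ, E) 𝓘(ℝ, G [⋀^Fin k]→L[ℝ] ℝ) ∞ a U)
    (hf : ContMDiffOn 𝓘(ℝ, E) 𝓘(ℝ, G) ∞ f U)
    (hη : ∀ z ∈ U, ∀ v, η z v = a z (fun i => mvfderiv 𝓘(ℝ, E) f z (v i)))
    {y : M} (hy : y ∈ U) (v : Fin (k + 1) → TangentSpace 𝓘(ℝ, E) y) :
    extDer η y v = ∑ i : Fin (k + 1), (-1 : ℝ) ^ (i : ℕ) *
      (mvfderiv 𝓘(ℝ, E) a y (v i)) (fun j => mvfderiv 𝓘(ℝ, E) f y (i.removeNth v j)) := by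
  set ψ := extChartAt 𝓘(ℝ, E) y with hψ
  have ha' := hasFDerivAt_chart (mdiff_of_smoothOn hU ha hy)
  have hf' := hasFDerivAt_chart (mdiff_of_smoothOn hU hf hy)
  have htar : ∀ᶠ z in 𝓝 (ψ y), z ∈ ψ.target ∧ ψ.symm z ∈ U := by
    have h1 : ψ.target ∈ 𝓝 (ψ y) := extChartAt_target_mem_nhds (I := 𝓘(ℝ, E)) y
    have h2 : ContinuousAt ψ.symm (ψ y) := continuousAt_extChartAt_symm y
    have h3 : ψ.symm (ψ y) = y := extChartAt_to_inv y
    filter_upwards [h1, h2.preimage_mem_nhds (by rw [h3]; exact hU.mem_nhds hy)] with z h h'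
    exact ⟨h, h'⟩
  -- Read in the chart, `η` is the pullback of `a ∘ ψ⁻¹` along the differential of `f ∘ ψ⁻¹`. This
  -- is the shape treated by `extDeriv_comp_fderiv`, where the second derivative of `f` disappears
  -- by symmetry.
  have heq : (fun z : E => ((η (ψ.symm z)).compContinuousLinearMap
      (mfderiv 𝓘(ℝ, E) 𝓘(ℝ, E) ψ.symm z) : E [⋀^Fin k]→L[ℝ] ℝ)) =ᶠ[𝓝 (ψ y)]
      fun z => (a (ψ.symm z)).compContinuousLinearMap (fderiv ℝ (fun z => f (ψ.symm z)) z) := by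
    filter_upwards [htar] with z hz
    ext w
    refine Eq.trans (hη _ hz.2 (fun i => mfderiv 𝓘(ℝ, E) 𝓘(ℝ, E) ψ.symm z (w i))) ?_
    rw [(fderiv_chart_symm hz.1 (mdiff_of_smoothOn hU hf hz.2)).fderiv]
    rfl
  have h1 := extDeriv_comp_fderiv ha'.differentiableAt (contDiffAt_chart hU hf hy) v
  rw [ha'.fderiv, hf'.fderiv] at h1
  refine Eq.trans ?_ h1
  rw [← heq.extDeriv_eq]
  -- The preferred chart at `y` has identity derivative at `y` itself, because the tangent space
  -- there is identified with `E` through that chart.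
  have h2 : (fun i => mfderiv 𝓘(ℝ, E) 𝓘(ℝ, E) ψ y (v i)) = v := funext fun i => by
    rw [mfderiv_extChartAt_self]; rfl
  exact congrArg (extDeriv (fun z : E => ((η (ψ.symm z)).compContinuousLinearMap
      (mfderiv 𝓘(ℝ, E) 𝓘(ℝ, E) ψ.symm z) : E [⋀^Fin k]→L[ℝ] ℝ)) (ψ y)) h2

end ManifoldCalculus

namespace PfaffianFibration

/-! ### One Pfaffian fibration: the induced connection and independence of lifts -/

section Single

variable {E : Type*} [NormedAddCommGroup E] [NormedSpace ℝ E]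
  {P : Type*} [TopologicalSpace P] [ChartedSpace E P] [IsManifold 𝓘(ℝ, E) ∞ P]
  {E' : Type*} [NormedAddCommGroup E'] [NormedSpace ℝ E']
  {X : Type*} [TopologicalSpace X] [ChartedSpace E' X] [IsManifold 𝓘(ℝ, E') ∞ X]
  (Q : PfaffianFibration E P E' X)

theorem rd_tr {k : ℕ} (α : Form Q.B k) {p y : P} (hp : y ∈ Q.base p) (b : Fin k → Q.B y) :
    Q.rd p α y (fun i => (trivializationAt E' Q.B p ⟨y, b i⟩).2) = α y b :=
  congrArg (α y) (funext fun i => Q.symmL_tr hp (b i))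

/-- The trivialization of `π*TX` is the pullback of the one of `TX`. This is what allows the matrix
of `Φ_*` to be defined over the base `X₁` instead of over `P₁`. -/
theorem symmL_eq {p y : P} (hp : y ∈ Q.base p) (w : E') :
    (trivializationAt E' Q.B p).symmL ℝ y w =
      (trivializationAt E' (TangentSpace 𝓘(ℝ, E') : X → Type _) (Q.proj p)).symmL ℝ
        (Q.proj y) w := by
  apply Q.tr_inj hp
  rw [Q.tr_symmL hp]
  have hp' : Q.proj y ∈
    (trivializationAt E' (TangentSpace 𝓘(ℝ, E') : X → Type _) (Q.proj p)).baseSet := hp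
  rw [Trivialization.symmL_apply _ hp']
  exact (congrArg Prod.snd ((trivializationAt E' (TangentSpace 𝓘(ℝ, E') : X → Type _)
    (Q.proj p)).apply_mk_symm hp' w)).symm

/-- The induced connection on forms is the derivative in any of the trivializations. -/
theorem covForm_eq [FiniteDimensional ℝ E] {k : ℕ} {α : Form Q.B k} {U : Set P} (hU : IsOpen U)
    (hα : IsSmoothFormOn E E' Q.B α U) {V : Set P} (hV : IsOpen V) {b : Fin k → Π x, Q.B x}
    (hb : ∀ i, IsSmoothSectionOn E E' Q.B (b i) V) {p y : P} (hy : y ∈ U) (hyV : y ∈ V)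
    (hp : y ∈ Q.base p) (v : Q.vert y) :
    Q.flatBundle.covForm α b y v =
      mvfderiv 𝓘(ℝ, E) (Q.rd p α) y (v : TangentSpace 𝓘(ℝ, E) y) (fun i => Q.tr p (b i) y) := by
  have ha := (hα p).contMDiffAt ((hU.inter (Q.isOpen_base p)).mem_nhds ⟨hy, hp⟩)
  have hg : ∀ i, ContMDiffAt 𝓘(ℝ, E) 𝓘(ℝ, E') ∞ (Q.tr p (b i)) y := fun i =>
    (Q.smooth_tr hV (hb i) p).contMDiffAt ((hV.inter (Q.isOpen_base p)).mem_nhds ⟨hyV, hp⟩)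
  have h1 : (fun z => α z fun i => b i z) =ᶠ[𝓝 y] fun z => Q.rd p α z fun i => Q.tr p (b i) z := by
    filter_upwards [(Q.isOpen_base p).mem_nhds hp] with z hz
    exact (Q.rd_tr α hz _).symm
  -- `tr_conn` turns the covariant derivative of `b i` into the derivative of its components, so
  -- each correction term of `covForm` becomes a term of the product rule.
  have h2 : ∀ i, α y (Function.update (fun j => b j y) i (Q.conn (b i) y v)) =
      Q.rd p α y (Function.update (fun j => Q.tr p (b j) y) i
        (mvfderiv 𝓘(ℝ, E) (Q.tr p (b i)) y (v : TangentSpace 𝓘(ℝ, E) y))) := by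
    intro i
    rw [← Q.tr_conn hV (hb i) hyV hp, ← Q.rd_tr α hp]
    congr 1
    funext j
    by_cases hj : j = i
    · subst hj; simp
    · rw [Function.update_of_ne hj, Function.update_of_ne hj]
  change mvfderiv 𝓘(ℝ, E) (fun z => α z fun i => b i z) y (v : TangentSpace 𝓘(ℝ, E) y) -
    ∑ i, α y (Function.update (fun j => b j y) i (Q.conn (b i) y v)) = _
  rw [mvfderiv_congr h1, mvfderiv_alternating_apply ha hg, Finset.sum_congr rfl fun i _ => h2 i,
    add_sub_cancel_right]

/-- The differential of a flat form on `π*TX`, evaluated on vectors in `C`, depends only on their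
projections. -/
theorem extDer_inclForm_congr [FiniteDimensional ℝ E] {k : ℕ} {α : Form Q.B k} {U : Set P}
    (hU : IsOpen U) (hα : Q.flatBundle.IsFlatFormOn α U) {y : P} (hy : y ∈ U)
    {c c' : Fin (k + 1) → TangentSpace 𝓘(ℝ, E) y} (hc : ∀ i, c i ∈ Q.C y) (hc' : ∀ i, c' i ∈ Q.C y)
    (h : ∀ i, Q.dproj y (c i) = Q.dproj y (c' i)) :
    extDer (Q.inclForm α) y c = extDer (Q.inclForm α) y c' := by
  have hm := Q.mem_base y
  rw [Q.extDer_inclForm hU hα.smooth hy hm, Q.extDer_inclForm hU hα.smooth hy hm]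
  refine Finset.sum_congr rfl fun i _ => ?_
  -- This is the only factor in which `c i` could enter beyond its projection. The difference `c i -
  -- c' i` lies in `C ∩ ker Tπ`, where the derivative of a flat form is zero.
  have h1 : mvfderiv 𝓘(ℝ, E) (Q.rd y α) y (c i) = mvfderiv 𝓘(ℝ, E) (Q.rd y α) y (c' i) := by
    have hv : c i - c' i ∈ Q.vert y :=
      ⟨Submodule.sub_mem _ (hc i) (hc' i), by
        let T : E →L[ℝ] E' := Q.dproj y
        exact (map_sub T (c i) (c' i)).trans (sub_eq_zero.2 (h i))⟩
    have := Q.rd_vert hU hα hy hm ⟨_, hv⟩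
    simp only [map_sub] at this
    exact sub_eq_zero.1 this
  -- The remaining arguments enter through the differential of a chart composed with `π`, hence only
  -- through `Tπ`.
  have h2 : (fun j => mvfderiv 𝓘(ℝ, E) (Q.fch y) y (i.removeNth c j)) =
      fun j => mvfderiv 𝓘(ℝ, E) (Q.fch y) y (i.removeNth c' j) := by
    funext j
    rw [Q.mvfderiv_fch hm, Q.mvfderiv_fch hm]
    exact congrArg (fun b : Q.B y => (trivializationAt E' Q.B y ⟨y, b⟩).2) (h _)
  rw [h1, h2]

end Single

/-! ### Morphisms: the chain rule and the foliations -/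

section Morphism

variable {E₁ : Type*} [NormedAddCommGroup E₁] [NormedSpace ℝ E₁]
  {P₁ : Type*} [TopologicalSpace P₁] [ChartedSpace E₁ P₁] [IsManifold 𝓘(ℝ, E₁) ∞ P₁]
  {E₁' : Type*} [NormedAddCommGroup E₁'] [NormedSpace ℝ E₁']
  {X₁ : Type*} [TopologicalSpace X₁] [ChartedSpace E₁' X₁] [IsManifold 𝓘(ℝ, E₁') ∞ X₁]
  {E₂ : Type*} [NormedAddCommGroup E₂] [NormedSpace ℝ E₂]
  {P₂ : Type*} [TopologicalSpace P₂] [ChartedSpace E₂ P₂] [IsManifold 𝓘(ℝ, E₂) ∞ P₂]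
  {E₂' : Type*} [NormedAddCommGroup E₂'] [NormedSpace ℝ E₂']
  {X₂ : Type*} [TopologicalSpace X₂] [ChartedSpace E₂' X₂] [IsManifold 𝓘(ℝ, E₂') ∞ X₂]
  {Q₁ : PfaffianFibration E₁ P₁ E₁' X₁} {Q₂ : PfaffianFibration E₂ P₂ E₂' X₂}

namespace Hom

variable (f : Hom Q₁ Q₂)

theorem mdiff_Φ (y : P₁) : MDifferentiableAt 𝓘(ℝ, E₁) 𝓘(ℝ, E₂) f.Φ y :=
  f.Φ.contMDiff.mdifferentiable (by simp) y

/-- The differential of `π₂ ∘ Φ = φ ∘ π₁`, and the only place where this square is differentiated as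
a whole; the local formulas for `Φ_*` and the comparison of lifts are drawn from it. -/
theorem bundleMap_dproj (y : P₁) (v : TangentSpace 𝓘(ℝ, E₁) y) :
    f.bundleMap y (Q₁.dproj y v) = Q₂.dproj (f.Φ y) (mfderiv 𝓘(ℝ, E₁) 𝓘(ℝ, E₂) f.Φ y v) := by
  have hcomm : (Q₂.proj ∘ f.Φ : P₁ → X₂) = f.φ ∘ Q₁.proj := funext f.comm
  have h1 := mfderiv_comp_apply y (Q₂.proj.contMDiff.mdifferentiable (by simp) (f.Φ y))
    (f.mdiff_Φ y) v
  have h2 := mfderiv_comp_apply y (f.φ.contMDiff.mdifferentiable (by simp) (Q₁.proj y))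
    (Q₁.proj.contMDiff.mdifferentiable (by simp) y) v
  -- The two composites are equal only propositionally, so their differentials land in tangent
  -- spaces at formally different points. Viewing both values in the model space `E₂'` makes the
  -- equation well typed.
  have h3 : ∀ g g' : P₁ → X₂, g = g' → (show E₂' from mfderiv 𝓘(ℝ, E₁) 𝓘(ℝ, E₂') g y v) =
      (show E₂' from mfderiv 𝓘(ℝ, E₁) 𝓘(ℝ, E₂') g' y v) := by rintro g _ rfl; rfl
  exact h2.symm.trans ((h3 _ _ hcomm.symm).trans h1)

/-- Membership in `C₂` is part of the morphism; verticality holds because `Tπ₂(TΦ v) = Φ_*(Tπ₁ v) =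
Φ_*(0)`. -/
theorem map_vert {y : P₁} {v : TangentSpace 𝓘(ℝ, E₁) y} (hv : v ∈ Q₁.vert y) :
    mfderiv 𝓘(ℝ, E₁) 𝓘(ℝ, E₂) f.Φ y v ∈ Q₂.vert (f.Φ y) := by
  refine ⟨f.map_C y v hv.1, ?_⟩
  have h : Q₁.dproj y v = 0 := hv.2
  change Q₂.dproj (f.Φ y) (mfderiv 𝓘(ℝ, E₁) 𝓘(ℝ, E₂) f.Φ y v) = 0
  rw [← f.bundleMap_dproj, h, map_zero]

/-! ### The canonical bundle map in trivializations -/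

/-- The points of `P₁` where both the trivialization around `p` and the one around `q` over `Φ` are
defined. -/
def dom (p : P₁) (q : P₂) : Set P₁ := Q₁.base p ∩ f.Φ ⁻¹' Q₂.base q

/-- The projection of `dom` to `X₁`. -/
def baseDom (p : P₁) (q : P₂) : Set X₁ :=
  (chartAt E₁' (Q₁.proj p)).source ∩ f.φ ⁻¹' (chartAt E₂' (Q₂.proj q)).source

theorem isOpen_dom (p : P₁) (q : P₂) : IsOpen (f.dom p q) :=
  (Q₁.isOpen_base p).inter ((Q₂.isOpen_base q).preimage f.Φ.contMDiff.continuous)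

theorem isOpen_baseDom (p : P₁) (q : P₂) : IsOpen (f.baseDom p q) :=
  (chartAt E₁' (Q₁.proj p)).open_source.inter
    ((chartAt E₂' (Q₂.proj q)).open_source.preimage f.φ.contMDiff.continuous)

theorem proj_mem_baseDom {p : P₁} {q : P₂} {y : P₁} (hy : y ∈ f.dom p q) :
    Q₁.proj y ∈ f.baseDom p q := by
  refine ⟨Q₁.proj_mem hy.1, ?_⟩
  rw [mem_preimage, ← f.comm]
  exact Q₂.proj_mem hy.2

/-- The map `φ`, read in the chart of `X₂` around `π₂(q)`. -/
def φch (q : P₂) (x : X₁) : E₂' := extChartAt 𝓘(ℝ, E₂') (Q₂.proj q) (f.φ x)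

theorem smooth_φch (p : P₁) (q : P₂) :
    ContMDiffOn 𝓘(ℝ, E₁') 𝓘(ℝ, E₂') ∞ (f.φch q) (f.baseDom p q) :=
  (contMDiffOn_extChartAt (I := 𝓘(ℝ, E₂')) (x := Q₂.proj q) (n := ∞)).comp
    f.φ.contMDiff.contMDiffOn (fun _ hy => hy.2)

theorem fch_Φ (q : P₂) (y : P₁) : Q₂.fch q (f.Φ y) = f.φch q (Q₁.proj y) := by
  simp only [fch, φch, f.comm]

/-- Since `π₁` is a submersion, `b` can be written as `Tπ₁(v)`, and both sides become the derivative
along `v` of one function on `P₁`, namely `fch q ∘ Φ = φch q ∘ π₁`. -/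
theorem tr_bundleMap {p : P₁} {q : P₂} {y : P₁} (hy : y ∈ f.dom p q) (b : Q₁.B y) :
    (trivializationAt E₂' Q₂.B q ⟨f.Φ y, f.bundleMap y b⟩).2 =
      mvfderiv 𝓘(ℝ, E₁') (f.φch q) (Q₁.proj y) b := by
  obtain ⟨v, rfl⟩ : ∃ v, Q₁.dproj y v = b := Q₁.submersion y b
  rw [f.bundleMap_dproj, ← Q₂.mvfderiv_fch hy.2, ← mvfderiv_comp_vec
    (mdiff_of_smoothOn (Q₂.isOpen_base q) (Q₂.smooth_fch q) hy.2) (f.mdiff_Φ y)]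
  simp only [f.fch_Φ]
  exact mvfderiv_comp_vec
    (mdiff_of_smoothOn (f.isOpen_baseDom p q) (f.smooth_φch p q) (f.proj_mem_baseDom hy))
    (Q₁.proj.contMDiff.mdifferentiable (by simp) y) v

/-- The differential of `φ`, read in the trivializations of `TX₁` around `π₁(p)` and of `TX₂` around
`π₂(q)`. -/
def dφ (p : P₁) (q : P₂) (x : X₁) : E₁' →L[ℝ] E₂' :=
  mvfderiv 𝓘(ℝ, E₁') (f.φch q) x ∘L
    (trivializationAt E₁' (TangentSpace 𝓘(ℝ, E₁') : X₁ → Type _) (Q₁.proj p)).symmL ℝ x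

/-- Applied to a fixed `w`, the matrix is the derivative of `φch q` along the local vector field
whose components in the trivialization are constantly `w`; both are smooth, and finitely many
columns suffice. -/
theorem smooth_dφ [FiniteDimensional ℝ E₁'] (p : P₁) (q : P₂) :
    ContMDiffOn 𝓘(ℝ, E₁') 𝓘(ℝ, E₁' →L[ℝ] E₂') ∞ (f.dφ p q) (f.baseDom p q) := by
  let e := trivializationAt E₁' (TangentSpace 𝓘(ℝ, E₁') : X₁ → Type _) (Q₁.proj p)
  refine smooth_clm_of_apply fun w => ?_
  have hs : IsSmoothFieldOn (fun x => e.symmL ℝ x w) (f.baseDom p q) := by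
    refine (e.contMDiffOn_section_iff (f.isOpen_baseDom p q) fun _ hx => hx.1).2 ?_
    refine (contMDiffOn_const (c := w)).congr fun x hx => ?_
    have hx' : x ∈ e.baseSet := hx.1
    rw [Trivialization.symmL_apply _ hx']
    exact congrArg Prod.snd (e.apply_mk_symm hx' w)
  exact smooth_mvfderiv (f.isOpen_baseDom p q) (f.smooth_φch p q) hs

theorem smooth_dφ_proj [FiniteDimensional ℝ E₁'] (p : P₁) (q : P₂) :
    ContMDiffOn 𝓘(ℝ, E₁) 𝓘(ℝ, E₁' →L[ℝ] E₂') ∞ (fun y => f.dφ p q (Q₁.proj y)) (f.dom p q) :=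
  (f.smooth_dφ p q).comp Q₁.proj.contMDiff.contMDiffOn fun _ hy => f.proj_mem_baseDom hy

/-- The matrix of `Φ_*` factors through `π₁`, so it does not vary to first order along `ker Tπ₁`.
This is why `Φ_*` respects the connections. -/
theorem mvfderiv_dφ_proj [FiniteDimensional ℝ E₁'] {p : P₁} {q : P₂} {y : P₁}
    (hy : y ∈ f.dom p q) (v : Q₁.vert y) :
    mvfderiv 𝓘(ℝ, E₁) (fun y => f.dφ p q (Q₁.proj y)) y (v : TangentSpace 𝓘(ℝ, E₁) y) = 0 := by
  have hv : mfderiv 𝓘(ℝ, E₁) 𝓘(ℝ, E₁') Q₁.proj y (v : TangentSpace 𝓘(ℝ, E₁) y) = 0 := v.2.2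
  rw [mvfderiv_comp_vec
    (mdiff_of_smoothOn (f.isOpen_baseDom p q) (f.smooth_dφ p q) (f.proj_mem_baseDom hy))
    (Q₁.proj.contMDiff.mdifferentiable (by simp) y), hv, map_zero]

theorem tr_bundleMap_eq {p : P₁} {q : P₂} {y : P₁} (hy : y ∈ f.dom p q) (b : Q₁.B y) :
    (trivializationAt E₂' Q₂.B q ⟨f.Φ y, f.bundleMap y b⟩).2 =
      f.dφ p q (Q₁.proj y) (trivializationAt E₁' Q₁.B p ⟨y, b⟩).2 := by
  rw [f.tr_bundleMap hy]
  have h := (Q₁.symmL_eq hy.1 _).symm.trans (Q₁.symmL_tr hy.1 b)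
  exact congrArg (mvfderiv 𝓘(ℝ, E₁') (f.φch q) (Q₁.proj y)) h.symm

theorem rd_pullbackForm {k : ℕ} (α : Form Q₂.B k) {p : P₁} {q : P₂} {y : P₁} (hy : y ∈ f.dom p q) :
    Q₁.rd p (pullbackForm f.Φ f.bundleMap α) y =
      (Q₂.rd q α (f.Φ y)).compContinuousLinearMap (f.dφ p q (Q₁.proj y)) := by
  ext w
  have h1 := Q₂.rd_tr α hy.2
    (fun i => f.bundleMap y ((trivializationAt E₁' Q₁.B p).symmL ℝ y (w i)))
  refine h1.symm.trans ?_
  simp only [f.tr_bundleMap_eq hy, Q₁.tr_symmL hy.1]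
  rfl

/-- In local trivializations the map consists of the smooth base map `Φ` and a smooth matrix applied
to the fibre coordinate. -/
theorem smooth_bundleMap [FiniteDimensional ℝ E₁'] :
    ContMDiff (𝓘(ℝ, E₁).prod 𝓘(ℝ, E₁')) (𝓘(ℝ, E₂).prod 𝓘(ℝ, E₂')) ∞
      (fun w : TotalSpace E₁' Q₁.B => TotalSpace.mk' E₂' (E := Q₂.B) (f.Φ w.proj)
        (f.bundleMap w.proj w.snd)) := by
  intro w₀
  have hproj : ContMDiffAt (𝓘(ℝ, E₁).prod 𝓘(ℝ, E₁')) 𝓘(ℝ, E₁) ∞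
      (fun w : TotalSpace E₁' Q₁.B => w.proj) w₀ := contMDiffAt_proj Q₁.B
  refine contMDiffAt_totalSpace.2 ⟨f.Φ.contMDiff.contMDiffAt.comp w₀ hproj, ?_⟩
  have hd : w₀.proj ∈ f.dom w₀.proj (f.Φ w₀.proj) := ⟨Q₁.mem_base _, Q₂.mem_base _⟩
  have hA := ((f.smooth_dφ_proj w₀.proj (f.Φ w₀.proj)).contMDiffAt
    ((f.isOpen_dom _ _).mem_nhds hd)).comp w₀ hproj
  -- Smoothness of the identity of the total space, read in the trivialization, is smoothness of the
  -- fibre coordinate.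
  have hb := (contMDiffAt_totalSpace.1 (contMDiffAt_id (I := 𝓘(ℝ, E₁).prod 𝓘(ℝ, E₁')) (n := ∞)
    (x := w₀))).2
  refine (hA.clm_apply hb).congr_of_eventuallyEq ?_
  filter_upwards [hproj.continuousAt.preimage_mem_nhds ((f.isOpen_dom _ _).mem_nhds hd)] with w hw
  exact f.tr_bundleMap_eq hw w.snd

/-! ### Pullback of forms: smoothness, connections, derivations -/

section Forms

variable {k : ℕ} {α : Form Q₂.B k} {U : Set P₂}

theorem smooth_rd_Φ (hU : IsOpen U) (hα : IsSmoothFormOn E₂ E₂' Q₂.B α U) (q : P₂) {y : P₁}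
    (hy : f.Φ y ∈ U) (hq : f.Φ y ∈ Q₂.base q) :
    ContMDiffAt 𝓘(ℝ, E₁) 𝓘(ℝ, E₂' [⋀^Fin k]→L[ℝ] ℝ) ∞ (fun z => Q₂.rd q α (f.Φ z)) y :=
  ((hα q).contMDiffAt ((hU.inter (Q₂.isOpen_base q)).mem_nhds ⟨hy, hq⟩)).comp y
    f.Φ.contMDiff.contMDiffAt

theorem rd_pullbackForm_eventuallyEq (α : Form Q₂.B k) {p : P₁} {q : P₂} {y : P₁}
    (hy : y ∈ f.dom p q) :
    Q₁.rd p (pullbackForm f.Φ f.bundleMap α) =ᶠ[𝓝 y] fun z =>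
      (Q₂.rd q α (f.Φ z)).compContinuousLinearMap (f.dφ p q (Q₁.proj z)) := by
  filter_upwards [(f.isOpen_dom p q).mem_nhds hy] with z hz
  exact f.rd_pullbackForm α hz

theorem smooth_pullbackForm [FiniteDimensional ℝ E₁'] (hU : IsOpen U)
    (hα : IsSmoothFormOn E₂ E₂' Q₂.B α U) :
    IsSmoothFormOn E₁ E₁' Q₁.B (pullbackForm f.Φ f.bundleMap α) (f.Φ ⁻¹' U) := by
  intro p y hy
  have hd : y ∈ f.dom p (f.Φ y) := ⟨hy.2, Q₂.mem_base _⟩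
  exact ((smooth_comp_clm (f.smooth_rd_Φ hU hα _ hy.1 hd.2)
    ((f.smooth_dφ_proj p _).contMDiffAt ((f.isOpen_dom _ _).mem_nhds hd))).congr_of_eventuallyEq
      (f.rd_pullbackForm_eventuallyEq α hd)).contMDiffWithinAt

/-- The local expression of `Φ*α` is that of `α` at `Φ`, pulled back along the matrix of `Φ_*`. In a
direction of the foliation the matrix contributes nothing, and the chain rule for `Φ` handles the
rest. -/
theorem mvfderiv_rd_pullbackForm [FiniteDimensional ℝ E₁'] (hU : IsOpen U)
    (hα : IsSmoothFormOn E₂ E₂' Q₂.B α U) {p : P₁} {q : P₂} {y : P₁} (hy : f.Φ y ∈ U)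
    (hd : y ∈ f.dom p q) (v : Q₁.vert y) :
    mvfderiv 𝓘(ℝ, E₁) (Q₁.rd p (pullbackForm f.Φ f.bundleMap α)) y (v : TangentSpace 𝓘(ℝ, E₁) y) =
      (mvfderiv 𝓘(ℝ, E₂) (Q₂.rd q α) (f.Φ y) (mfderiv 𝓘(ℝ, E₁) 𝓘(ℝ, E₂) f.Φ y
        (v : TangentSpace 𝓘(ℝ, E₁) y))).compContinuousLinearMap (f.dφ p q (Q₁.proj y)) := by
  rw [mvfderiv_congr (f.rd_pullbackForm_eventuallyEq α hd),
    mvfderiv_comp_clm (f.smooth_rd_Φ hU hα _ hy hd.2)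
      ((f.smooth_dφ_proj p _).contMDiffAt ((f.isOpen_dom _ _).mem_nhds hd)) _
      (f.mvfderiv_dφ_proj hd v),
    mvfderiv_comp_vec (g := Q₂.rd q α) (f := f.Φ)
      (mdiff_of_smoothOn (hU.inter (Q₂.isOpen_base q)) (hα q) ⟨hy, hd.2⟩) (f.mdiff_Φ y)]

/-- The canonical bundle map is compatible with the induced connections on forms. -/
theorem covForm_pullbackForm [FiniteDimensional ℝ E₁] [FiniteDimensional ℝ E₁']
    [FiniteDimensional ℝ E₂] (hU : IsOpen U) (hα : IsSmoothFormOn E₂ E₂' Q₂.B α U) {y : P₁}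
    (hy : f.Φ y ∈ U) (v : Q₁.vert y) {V₁ : Set P₁} (hV₁ : IsOpen V₁) (hy₁ : y ∈ V₁)
    {b₁ : Fin k → Π x, Q₁.B x} (hb₁ : ∀ i, IsSmoothSectionOn E₁ E₁' Q₁.B (b₁ i) V₁)
    {V₂ : Set P₂} (hV₂ : IsOpen V₂) (hy₂ : f.Φ y ∈ V₂) {b₂ : Fin k → Π x, Q₂.B x}
    (hb₂ : ∀ i, IsSmoothSectionOn E₂ E₂' Q₂.B (b₂ i) V₂)
    (h : ∀ i, b₂ i (f.Φ y) = f.bundleMap y (b₁ i y)) :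
    Q₂.flatBundle.covForm α b₂ (f.Φ y) ⟨mfderiv 𝓘(ℝ, E₁) 𝓘(ℝ, E₂) f.Φ y v, f.map_vert v.2⟩ =
      Q₁.flatBundle.covForm (pullbackForm f.Φ f.bundleMap α) b₁ y v := by
  have hd : y ∈ f.dom y (f.Φ y) := ⟨Q₁.mem_base _, Q₂.mem_base _⟩
  refine (Q₂.covForm_eq hU hα hV₂ hb₂ hy hy₂ (Q₂.mem_base _) ⟨_, f.map_vert v.2⟩).trans (Eq.symm ?_)
  refine (Q₁.covForm_eq (hU.preimage f.Φ.contMDiff.continuous) (f.smooth_pullbackForm hU hα) hV₁ hb₁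
    hy hy₁ (Q₁.mem_base _) v).trans ?_
  rw [f.mvfderiv_rd_pullbackForm hU hα hy hd]
  -- After `covForm_eq` the sections enter only through their values at `y` and `Φ y`, so `h`
  -- suffices and no relation between `b₁` and `b₂` at nearby points is needed.
  simp only [tr, h, f.tr_bundleMap_eq hd]
  rfl

/-- Working with local expressions avoids extending `Φ_*(b)` to a section of `π₂*TX₂`: the
derivative of `α` along `TΦ(v)` is already zero by `rd_vert`, since `TΦ(v)` lies in the second
foliation. -/
theorem flat_pullbackForm [FiniteDimensional ℝ E₁] [FiniteDimensional ℝ E₁']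
    [FiniteDimensional ℝ E₂] (hU : IsOpen U) (hα : Q₂.flatBundle.IsFlatFormOn α U) :
    Q₁.flatBundle.IsFlatFormOn (pullbackForm f.Φ f.bundleMap α) (f.Φ ⁻¹' U) := by
  refine ⟨f.smooth_pullbackForm hU hα.smooth, fun y hy (v : Q₁.vert y) V b hV hyV hb => ?_⟩
  have hd : y ∈ f.dom y (f.Φ y) := ⟨Q₁.mem_base _, Q₂.mem_base _⟩
  refine (Q₁.covForm_eq (hU.preimage f.Φ.contMDiff.continuous) (f.smooth_pullbackForm hU hα.smooth)
    hV hb hy hyV (Q₁.mem_base _) v).trans ?_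
  rw [f.mvfderiv_rd_pullbackForm hU hα.smooth hy hd,
    Q₂.rd_vert hU hα hy hd.2 ⟨_, f.map_vert v.2⟩]
  rfl

/-- The exterior derivative commutes with the pullback of forms on `π₂*TX₂`. -/
theorem extDer_inclForm_pullbackForm (hU : IsOpen U) (hα : IsSmoothFormOn E₂ E₂' Q₂.B α U) {y : P₁}
    (hy : f.Φ y ∈ U) (v : Fin (k + 1) → TangentSpace 𝓘(ℝ, E₁) y) :
    extDer (Q₁.inclForm (pullbackForm f.Φ f.bundleMap α)) y v =
      extDer (Q₂.inclForm α) (f.Φ y) (fun i => mfderiv 𝓘(ℝ, E₁) 𝓘(ℝ, E₂) f.Φ y (v i)) := by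
  set q := f.Φ y
  have hO := hU.inter (Q₂.isOpen_base q)
  have hO' : IsOpen (f.Φ ⁻¹' (U ∩ Q₂.base q)) := hO.preimage f.Φ.contMDiff.continuous
  have hyO : y ∈ f.Φ ⁻¹' (U ∩ Q₂.base q) := ⟨hy, Q₂.mem_base q⟩
  have hfch : ∀ z ∈ f.Φ ⁻¹' (U ∩ Q₂.base q), ∀ u, mvfderiv 𝓘(ℝ, E₁) (fun z => Q₂.fch q (f.Φ z)) z u =
      mvfderiv 𝓘(ℝ, E₂) (Q₂.fch q) (f.Φ z) (mfderiv 𝓘(ℝ, E₁) 𝓘(ℝ, E₂) f.Φ z u) := fun z hz u =>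
    mvfderiv_comp_vec (mdiff_of_smoothOn (Q₂.isOpen_base q) (Q₂.smooth_fch q) hz.2) (f.mdiff_Φ z) u
  -- Near `Φ y` the form `α ∘ Tπ₂` is `a(dg, …, dg)` with `a = rd q α` and `g = fch q`; its pullback
  -- is `(a ∘ Φ)(d(g ∘ Φ), …)`. Both exterior derivatives have the same explicit formula, and the
  -- chain rule matches them term by term, with no trivialization of `π₁*TX₁`.
  rw [extDer_of_comp_mvfderiv (a := fun z => Q₂.rd q α (f.Φ z)) (f := fun z => Q₂.fch q (f.Φ z)) hO'
    ((hα q).comp f.Φ.contMDiff.contMDiffOn fun _ hz => hz)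
    ((Q₂.smooth_fch q).comp f.Φ.contMDiff.contMDiffOn fun _ hz => hz.2) ?_ hyO,
    Q₂.extDer_inclForm hU hα hy (Q₂.mem_base q)]
  · refine Finset.sum_congr rfl fun i _ => ?_
    rw [mvfderiv_comp_vec (g := Q₂.rd q α) (f := f.Φ) (mdiff_of_smoothOn hO (hα q) hyO)
      (f.mdiff_Φ y)]
    simp only [hfch y hyO]
    rfl
  -- What remains is that `(Φ*α) ∘ Tπ₁` is the pullback by `Φ` of `α ∘ Tπ₂`, which is
  -- `bundleMap_dproj` in each argument.
  · intro z hz u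
    simp only [hfch z hz]
    rw [← Q₂.inclForm_apply α hz.2]
    exact congrArg (α (f.Φ z)) (funext fun i => f.bundleMap_dproj z (u i))

/-- On `b`, the left side evaluates `d(α ∘ Tπ₂)` on the chosen lifts of `Φ_*(b i)`, and the right
side evaluates it on the images under `TΦ` of the chosen lifts of `b i`. Both families lie in `C₂`
over the same vectors, so flatness of `α` identifies the values. -/
theorem pullbackForm_D [FiniteDimensional ℝ E₁'] [FiniteDimensional ℝ E₂] [FiniteDimensional ℝ E₂']
    (hU : IsOpen U) (hα : Q₂.flatBundle.IsFlatFormOn α U) {y : P₁} (hy : f.Φ y ∈ U) :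
    pullbackForm f.Φ f.bundleMap (Q₂.D α) y = Q₁.D (pullbackForm f.Φ f.bundleMap α) y := by
  ext b
  refine Eq.trans ?_ (f.extDer_inclForm_pullbackForm hU hα.smooth hy
    (fun i => Q₁.lift y (b i))).symm
  refine Q₂.extDer_inclForm_congr hU hα hy (fun i => Q₂.lift_mem _ _)
    (fun i => f.map_C y _ (Q₁.lift_mem _ _)) fun i => ?_
  rw [← f.bundleMap_dproj, Q₁.dproj_lift]
  exact Q₂.dproj_lift _ _

end Forms

end Hom
end Morphism
end PfaffianFibration
end RelAlg

end

/-! ### The morphism of relative algebroids -/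

theorem mainTheorem9
    {E₁ : Type*} [NormedAddCommGroup E₁] [NormedSpace ℝ E₁] [FiniteDimensional ℝ E₁]
    {P₁ : Type*} [TopologicalSpace P₁] [ChartedSpace E₁ P₁] [IsManifold 𝓘(ℝ, E₁) ∞ P₁]
    {E₁' : Type*} [NormedAddCommGroup E₁'] [NormedSpace ℝ E₁'] [FiniteDimensional ℝ E₁']
    {X₁ : Type*} [TopologicalSpace X₁] [ChartedSpace E₁' X₁] [IsManifold 𝓘(ℝ, E₁') ∞ X₁]
    {E₂ : Type*} [NormedAddCommGroup E₂] [NormedSpace ℝ E₂] [FiniteDimensional ℝ E₂]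
    {P₂ : Type*} [TopologicalSpace P₂] [ChartedSpace E₂ P₂] [IsManifold 𝓘(ℝ, E₂) ∞ P₂]
    {E₂' : Type*} [NormedAddCommGroup E₂'] [NormedSpace ℝ E₂'] [FiniteDimensional ℝ E₂']
    {X₂ : Type*} [TopologicalSpace X₂] [ChartedSpace E₂' X₂] [IsManifold 𝓘(ℝ, E₂') ∞ X₂]
    (Q₁ : RelAlg.PfaffianFibration E₁ P₁ E₁' X₁) (Q₂ : RelAlg.PfaffianFibration E₂ P₂ E₂' X₂)
    (f : RelAlg.PfaffianFibration.Hom Q₁ Q₂) :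
    RelAlg.IsRelativeAlgebroidMorphism Q₁.relativeAlgebroid Q₂.relativeAlgebroid f.Φ f.bundleMap where
  smooth_base := f.Φ.contMDiff
  smooth := f.smooth_bundleMap
  map_fol _ _ hv := f.map_vert hv
  -- The condition on sections of the dual bundle is the degree-one case of `covForm_pullbackForm`,
  -- whose families of sections are then constant.
  map_conn _ _ hU hα _ hx v _ _ _ _ hV₁ hx₁ hb₁ hV₂ hx₂ hb₂ h :=
    f.covForm_pullbackForm hU hα hx v hV₁ hx₁ (fun _ => hb₁) hV₂ hx₂ (fun _ => hb₂) fun _ => h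
  map_flat _ _ hU hα := f.flat_pullbackForm hU hα
  map_D _ _ hU hα _ hx := f.pullbackForm_D hU hα hx
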